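/- Let $\nu\ge 1$ and let $\mathbf T^\nu=(\mathbf R/2\pi\mathbf Z)^\nu$ with Lebesgue measure. Let $w_0\in\mathbf R$, let $w_1,v_0,v_1:\mathbf T^\nu\to\mathbf R$ be continuous, and let $w_2,v_2:(\mathbf T^\nu)^2\to\mathbf R$ be continuous and symmetric. On $L_2((\mathbf T^\nu)^2)$ put $$(V_1f)(p,q)=\int_{\mathbf T^\nu}v_2(p,s)f(s,q)\,ds,\qquad (V_2f)(p,q)=\int_{\mathbf T^\nu}v_2(s,q)f(p,s)\,ds,\qquad (H_{22}^0f)(p,q)=w_2(p,q)f(p,q),$$ and assume that $V_1$ and $V_2$ are positive operators, i.e. $(V_if,f)\ge 0$ for all $f$. Let $L_2^s((\mathbf T^\nu)^2)$ be the subspace of symmetric functions and let $H$ be the bounded self-adjoint operator on $\mathbf C\oplus L_2(\mathbf T^\nu)\oplus L_2^s((\mathbf T^\nu)^2)$ given by $$H=\begin{pmatrix}H_{00}&H_{01}&0\\H_{10}&H_{11}&H_{12}\\0&H_{21}&H_{22}\end{pmatrix},$$ where $H_{00}f_0=w_0f_0$, $H_{01}f_1=\int v_0(s)f_1(s)\,ds$,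 $(H_{10}f_0)(p)=v_0(p)f_0$, $(H_{11}f_1)(p)=w_1(p)f_1(p)$, $(H_{12}f_2)(p)=\int v_1(s)f_2(p,s)\,ds$, $(H_{21}f_1)(p,q)=\frac12\bigl(v_1(p)f_1(q)+v_1(q)f_1(p)\bigr)$ and $H_{22}=H_{22}^0-V_1-V_2$. Let the channel operator be the bounded self-adjoint operator $$\hat H=\begin{pmatrix}H_{11}&\frac1{\sqrt2}H_{12}\\ \frac1{\sqrt2}H_{21}^{(1)}&H_{22}^0-V_2\end{pmatrix}\quad\text{on } L_2(\mathbf T^\nu)\oplus L_2((\mathbf T^\nu)^2),\qquad (H_{21}^{(1)}f_1)(p,q)=v_1(q)f_1(p),$$ where $H_{12}$ is given by the same formula on all of $L_2((\mathbf T^\nu)^2)$. For $p\in\mathbf T^\nu$ let $h(p)$ be the bounded self-adjoint operator on $\mathbf C\oplus L_2(\mathbf T^\nu)$ that maps $(f_0,f_1)$ to $(g_0,g_1)$ with $$g_0=w_1(p)f_0+\tfrac1{\sqrt2}\int v_1(s)f_1(s)\,ds,\qquad g_1(q)=\tfrac1{\sqrt2}v_1(q)f_0+w_2(p,q)f_1(q)-\int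 v_2(q,s)f_1(s)\,ds.$$ Let $m=\min w_2$ and $M=\max w_2$. For a bounded self-adjoint operator, $\sigma_{disc}$ denotes the set of isolated points of the spectrum $\sigma$ that are eigenvalues of finite multiplicity, and $\sigma_{ess}=\sigma\setminus\sigma_{disc}$. Then the essential spectrum of $H$ coincides with the spectrum of $\hat H$, and this set is described by the fiber operators: $$\sigma_{ess}(H)=\sigma(\hat H)=\bigcup_{p\in\mathbf T^\nu}\sigma_{disc}(h(p))\;\cup\;[m,M].$$ -/

import Mathlib

open MeasureTheory Topology Filter
open scoped ENNReal NNReal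

noncomputable section

namespace FockModel

/-! ### Discrete and essential spectrum -/

/-- The discrete spectrum of a bounded self-adjoint operator on a complex Hilbert space: the
isolated points of the spectrum that are eigenvalues of finite multiplicity. -/
def discreteSpectrum {E : Type*} [NormedAddCommGroup E] [NormedSpace ℂ E] (A : E →L[ℂ] E) :
    Set ℂ :=
  {z | z ∈ spectrum ℂ A ∧ (∀ᶠ w in 𝓝[≠] z, w ∉ spectrum ℂ A) ∧
    Module.End.HasEigenvalue (A : E →ₗ[ℂ] E) z ∧
    FiniteDimensional ℂ (Module.End.eigenspace (A : E →ₗ[ℂ] E) z)}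

/-- The essential spectrum of a bounded self-adjoint operator on a complex Hilbert space: the
complement in the spectrum of the discrete spectrum. -/
def essentialSpectrum {E : Type*} [NormedAddCommGroup E] [NormedSpace ℂ E] (A : E →L[ℂ] E) :
    Set ℂ :=
  spectrum ℂ A \ discreteSpectrum A

/-! ### Two elementary bounded operators between `L²` spaces -/

section Operators

variable {X Y : Type*} [MeasureSpace X] [MeasureSpace Y]

/-- `L²(X)`, complex valued, with respect to `volume`. -/
abbrev L2 (X : Type*) [MeasureSpace X] : Type _ := Lp ℂ 2 (volume : Measure X)

/-- `φ` pushes the measure of `X` forward to at most a multiple of the measure of `Y`, so that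
`f ↦ f ∘ φ` is bounded from `L²(Y)` to `L²(X)`. -/
def BoundedPullback (φ : X → Y) : Prop :=
  Measurable φ ∧ ∃ c : ℝ≥0, Measure.map φ (volume : Measure X) ≤ c • (volume : Measure Y)

theorem BoundedPullback.qmp {φ : X → Y} (h : BoundedPullback φ) :
    Measure.QuasiMeasurePreserving φ volume volume := by
  obtain ⟨hm, c, hc⟩ := h
  refine ⟨hm, ?_⟩
  exact (Measure.absolutelyContinuous_of_le hc).trans (Measure.smul_absolutelyContinuous)

theorem BoundedPullback.bound {φ : X → Y} (h : BoundedPullback φ) {k : X → ℝ}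
    {C : ℝ≥0} (hC : ∀ x, ‖k x‖ ≤ C) :
    ∃ D : ℝ≥0, ∀ f : Y → ℂ, AEStronglyMeasurable f volume →
      eLpNorm (fun x => (k x : ℂ) * f (φ x)) 2 volume ≤ D * eLpNorm f 2 volume := by
  obtain ⟨c, hc⟩ := h.2
  have h1 : AEMeasurable φ (volume : Measure X) := h.1.aemeasurable
  refine ⟨C * c ^ (1 / 2 : ℝ), fun f hf => ?_⟩
  have h2 : eLpNorm (fun x => (k x : ℂ) * f (φ x)) 2 volume
      ≤ C * eLpNorm (f ∘ φ) 2 (volume : Measure X) := by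
    have := eLpNorm_le_nnreal_smul_eLpNorm_of_ae_le_mul (μ := (volume : Measure X))
      (f := fun x => (k x : ℂ) * f (φ x)) (g := f ∘ φ) (c := C)
      (Eventually.of_forall fun x => by
        rw [← NNReal.coe_le_coe]
        simp only [coe_nnnorm, NNReal.coe_mul, norm_mul, Complex.norm_real, Function.comp]
        exact mul_le_mul_of_nonneg_right (hC x) (norm_nonneg _)) 2
    simpa [ENNReal.smul_def] using this
  have hf' : AEStronglyMeasurable f (Measure.map φ volume) := hf.mono_ac h.qmp.2
  have h3 : eLpNorm (f ∘ φ) 2 (volume : Measure X) ≤ (c : ℝ≥0∞) ^ (1 / 2 : ℝ) *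
      eLpNorm f 2 volume := by
    rw [← eLpNorm_map_measure hf' h1]
    refine (eLpNorm_mono_measure f hc).trans ?_
    have := eLpNorm_smul_measure_of_ne_top (p := 2) (by simp) f (c : ℝ≥0∞)
      (μ := (volume : Measure Y))
    have h4 : (c • (volume : Measure Y)) = (c : ℝ≥0∞) • (volume : Measure Y) := rfl
    rw [h4, this]
    simp
  calc _ ≤ _ := h2
    _ ≤ C * ((c : ℝ≥0∞) ^ (1 / 2 : ℝ) * eLpNorm f 2 volume) := by gcongr
    _ = _ := by
      rw [ENNReal.coe_mul, ENNReal.coe_rpow_of_nonneg _ (by norm_num), mul_assoc]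

theorem exists_bound {X : Type*} [TopologicalSpace X] [CompactSpace X] {k : X → ℝ} (hk : Continuous k) : ∃ C : ℝ≥0, ∀ x, ‖k x‖ ≤ C := by
  obtain ⟨C, hC⟩ := isCompact_univ.exists_bound_of_continuousOn hk.continuousOn
  exact ⟨C.toNNReal, fun x => (hC x (Set.mem_univ x)).trans (Real.le_coe_toNNReal C)⟩

variable [TopologicalSpace X] [CompactSpace X] [OpensMeasurableSpace X]

theorem memLp_weighted {φ : X → Y} (hφ : BoundedPullback φ) {k : X → ℝ} (hk : Continuous k)
    (f : L2 Y) : MemLp (fun x => (k x : ℂ) * f (φ x)) 2 volume := by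
  obtain ⟨C, hC⟩ := exists_bound hk
  obtain ⟨D, hD⟩ := hφ.bound hC
  refine ⟨?_, ?_⟩
  · refine AEStronglyMeasurable.mul ?_ ((Lp.aestronglyMeasurable f).comp_quasiMeasurePreserving hφ.qmp)
    exact (Complex.measurable_ofReal.comp hk.measurable).aestronglyMeasurable
  · exact (hD f (Lp.aestronglyMeasurable f)).trans_lt
      (ENNReal.mul_lt_top ENNReal.coe_lt_top (Lp.memLp f).2)

/-- The weighted composition operator `(W f)(x) = k(x) f(φ(x))` from `L²(Y)` to `L²(X)`. -/
def weightedComp (k : X → ℝ) (hk : Continuous k) (φ : X → Y) (hφ : BoundedPullback φ) :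
    L2 Y →L[ℂ] L2 X :=
  LinearMap.mkContinuousOfExistsBound
    { toFun := fun f => (memLp_weighted hφ hk f).toLp (fun x => (k x : ℂ) * f (φ x))
      map_add' := fun f g => by
        rw [← MemLp.toLp_add, MemLp.toLp_eq_toLp_iff]
        filter_upwards [hφ.qmp.ae (Lp.coeFn_add f g)] with x hx
        rw [hx, Pi.add_apply, Pi.add_apply, mul_add]
      map_smul' := fun c f => by
        rw [RingHom.id_apply, ← MemLp.toLp_const_smul, MemLp.toLp_eq_toLp_iff]
        filter_upwards [hφ.qmp.ae (Lp.coeFn_smul c f)] with x hx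
        rw [hx, Pi.smul_apply, Pi.smul_apply, smul_eq_mul, smul_eq_mul, mul_left_comm] }
    (by
      obtain ⟨C, hC⟩ := exists_bound hk
      obtain ⟨D, hD⟩ := hφ.bound hC
      refine ⟨D, fun f => ?_⟩
      simp only [LinearMap.coe_mk, AddHom.coe_mk]
      rw [Lp.norm_toLp, Lp.norm_def]
      rw [← ENNReal.coe_toReal D, ← ENNReal.toReal_mul]
      exact ENNReal.toReal_mono (ENNReal.mul_ne_top ENNReal.coe_ne_top (Lp.memLp f).2.ne)
        (hD f (Lp.aestronglyMeasurable f)))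

theorem coeFn_weightedComp (k : X → ℝ) (hk : Continuous k) (φ : X → Y)
    (hφ : BoundedPullback φ) (f : L2 Y) :
    weightedComp k hk φ hφ f =ᵐ[volume] fun x => (k x : ℂ) * f (φ x) :=
  MemLp.coeFn_toLp (memLp_weighted hφ hk f)

end Operators

section Integration

variable {X S : Type*} [MeasureSpace X] [MeasureSpace S]
  [IsFiniteMeasure (volume : Measure S)]

theorem eLpNorm_integral_le [SFinite (volume : Measure X)] (F : L2 (X × S)) :
    eLpNorm (fun x => ∫ s : S, F (x, s)) 2 (volume : Measure X) ≤
      ((volume : Measure S) Set.univ) ^ (1 / 2 : ℝ) * eLpNorm F 2 volume := by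
  have hF := Lp.aestronglyMeasurable F
  have hsec : ∀ᵐ x : X, AEStronglyMeasurable (fun s : S => F (x, s)) volume :=
    hF.prodMk_left
  have two : (2 : ℝ≥0∞).toReal = 2 := by simp
  rw [eLpNorm_eq_lintegral_rpow_enorm_toReal (by simp) (by simp),
    eLpNorm_eq_lintegral_rpow_enorm_toReal (by simp) (by simp), two,
    ← ENNReal.mul_rpow_of_nonneg _ _ (by norm_num)]
  refine ENNReal.rpow_le_rpow ?_ (by norm_num)
  have hpow : AEMeasurable (fun z : X × S => ‖F z‖ₑ ^ (2 : ℝ)) (volume.prod volume) :=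
    hF.enorm.pow_const _
  have : ∫⁻ z : X × S, ‖F z‖ₑ ^ (2 : ℝ) = ∫⁻ x : X, ∫⁻ s : S, ‖F (x, s)‖ₑ ^ (2 : ℝ) :=
    lintegral_prod _ hpow
  rw [this, ← lintegral_const_mul' _ _ (measure_ne_top _ _)]
  refine lintegral_mono_ae ?_
  filter_upwards [hsec] with x hx
  have h1 : ‖∫ s : S, F (x, s)‖ₑ ≤ eLpNorm (fun s : S => F (x, s)) 1 volume := by
    rw [eLpNorm_one_eq_lintegral_enorm]
    exact enorm_integral_le_lintegral_enorm _
  have h2 := eLpNorm_le_eLpNorm_mul_rpow_measure_univ (p := 1) (q := 2) (by norm_num) hx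
  have h3 := ENNReal.rpow_le_rpow (h1.trans h2) (z := 2) (by norm_num)
  refine h3.trans (le_of_eq ?_)
  rw [ENNReal.mul_rpow_of_nonneg _ _ (by norm_num), ← ENNReal.rpow_mul,
    eLpNorm_eq_lintegral_rpow_enorm_toReal (by simp) (by simp), ← ENNReal.rpow_mul, two, mul_comm]
  norm_num

variable [IsFiniteMeasure (volume : Measure X)]

theorem memLp_integral (F : L2 (X × S)) :
    MemLp (fun x => ∫ s : S, F (x, s)) 2 (volume : Measure X) :=
  ⟨(Lp.aestronglyMeasurable F).integral_prod_right',
    (eLpNorm_integral_le F).trans_lt (ENNReal.mul_lt_top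
      (ENNReal.rpow_lt_top_of_nonneg (by norm_num) (measure_ne_top _ _)) (Lp.memLp F).2)⟩

theorem ae_integrable_section (F : L2 (X × S)) :
    ∀ᵐ x : X, Integrable (fun s : S => F (x, s)) volume :=
  Integrable.prod_right_ae (μ := (volume : Measure X)) (ν := (volume : Measure S))
    ((Lp.memLp F).integrable (by norm_num))

/-- Integration over the last variable, `F ↦ (x ↦ ∫ F(x, s) ds)`, from `L²(X × S)` to `L²(X)`. -/
def integrateLast : L2 (X × S) →L[ℂ] L2 X :=
  LinearMap.mkContinuousOfExistsBound
    { toFun := fun F => (memLp_integral F).toLp (fun x => ∫ s : S, F (x, s))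
      map_add' := fun F G => by
        rw [← MemLp.toLp_add, MemLp.toLp_eq_toLp_iff]
        filter_upwards [ae_integrable_section F, ae_integrable_section G,
          Measure.ae_ae_of_ae_prod (Lp.coeFn_add F G)] with x hF hG hx
        rw [integral_congr_ae hx]
        exact integral_add hF hG
      map_smul' := fun c F => by
        rw [RingHom.id_apply, ← MemLp.toLp_const_smul, MemLp.toLp_eq_toLp_iff]
        filter_upwards [Measure.ae_ae_of_ae_prod (Lp.coeFn_smul c F)] with x hx
        rw [integral_congr_ae hx]
        exact integral_smul c _ }
    (by
      refine ⟨(((volume : Measure S) Set.univ) ^ (1 / 2 : ℝ)).toReal, fun F => ?_⟩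
      simp only [LinearMap.coe_mk, AddHom.coe_mk]
      rw [Lp.norm_toLp, Lp.norm_def]
      rw [← ENNReal.toReal_mul]
      exact ENNReal.toReal_mono (ENNReal.mul_ne_top
        (ENNReal.rpow_lt_top_of_nonneg (by norm_num) (measure_ne_top _ _)).ne (Lp.memLp F).2.ne)
        (eLpNorm_integral_le F))

theorem coeFn_integrateLast (F : L2 (X × S)) :
    integrateLast F =ᵐ[volume] fun x => ∫ s : S, F (x, s) :=
  MemLp.coeFn_toLp (memLp_integral F)

variable {Y : Type*} [MeasureSpace Y] [TopologicalSpace X] [TopologicalSpace S] [CompactSpace X]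
  [CompactSpace S] [OpensMeasurableSpace X] [OpensMeasurableSpace S] [SecondCountableTopology S]

/-- The partial integral operator `(P f)(x) = ∫ k(x, s) f(φ(x, s)) ds` from `L²(Y)` to `L²(X)`. -/
def partialIntegral (k : X × S → ℝ) (hk : Continuous k) (φ : X × S → Y)
    (hφ : BoundedPullback φ) : L2 Y →L[ℂ] L2 X :=
  integrateLast ∘L weightedComp k hk φ hφ

theorem coeFn_partialIntegral (k : X × S → ℝ) (hk : Continuous k) (φ : X × S → Y)
    (hφ : BoundedPullback φ) (f : L2 Y) :
    partialIntegral k hk φ hφ f =ᵐ[volume] fun x => ∫ s : S, (k (x, s) : ℂ) * f (φ (x, s)) := by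
  refine (coeFn_integrateLast _).trans ?_
  filter_upwards [Measure.ae_ae_of_ae_prod (coeFn_weightedComp k hk φ hφ f)] with x hx
  exact integral_congr_ae hx

end Integration

section Functional

variable {X : Type*} [MeasureSpace X] [IsFiniteMeasure (volume : Measure X)] [TopologicalSpace X]
  [CompactSpace X] [OpensMeasurableSpace X]

theorem memLp_continuous {k : X → ℝ} (hk : Continuous k) :
    MemLp (fun x => (k x : ℂ)) 2 (volume : Measure X) := by
  obtain ⟨C, hC⟩ := exists_bound hk
  exact MemLp.of_bound (Complex.measurable_ofReal.comp hk.measurable).aestronglyMeasurable C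
    (Eventually.of_forall fun x => by simpa using hC x)

theorem integral_mul_eq_inner {k : X → ℝ} (hk : Continuous k) (f : L2 X) :
    ∫ x : X, (k x : ℂ) * f x = inner ℂ ((memLp_continuous hk).toLp _) f := by
  rw [L2.inner_def]
  refine integral_congr_ae ?_
  filter_upwards [(memLp_continuous hk).coeFn_toLp] with x hx
  rw [hx]
  simp [mul_comm]

/-- The bounded functional `f ↦ ∫ k(s) f(s) ds` on `L²(X)`. -/
def functional (k : X → ℝ) (hk : Continuous k) : L2 X →L[ℂ] ℂ :=
  LinearMap.mkContinuousOfExistsBound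
    { toFun := fun f => ∫ x : X, (k x : ℂ) * f x
      map_add' := fun f g => by
        simp only [integral_mul_eq_inner hk, inner_add_right]
      map_smul' := fun c f => by
        simp only [integral_mul_eq_inner hk, inner_smul_right, RingHom.id_apply, smul_eq_mul] }
    ⟨‖(memLp_continuous hk).toLp _‖, fun f => by
      simp only [LinearMap.coe_mk, AddHom.coe_mk, integral_mul_eq_inner hk]
      exact norm_inner_le_norm _ _⟩

/-- The multiple `c k` of a continuous function `k` as an element of `L²(X)`, linearly in `c`. -/
def creation (k : X → ℝ) (hk : Continuous k) : ℂ →L[ℂ] L2 X :=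
  ContinuousLinearMap.toSpanSingleton ℂ ((memLp_continuous hk).toLp (fun x => (k x : ℂ)))

end Functional

/-! ### The torus and the spaces of the model -/

instance two_pi_pos_fact : Fact (0 < 2 * Real.pi) := ⟨Real.two_pi_pos⟩

/-- The torus `(ℝ / 2πℤ)^ν`; its `volume` is Lebesgue measure, of total mass `(2π)^ν`. -/
abbrev Torus (ν : ℕ) : Type := Fin ν → AddCircle (2 * Real.pi)

variable {ν : ℕ}

/-- The space of symmetric square integrable functions of two variables. -/
def symmL2 (ν : ℕ) : Submodule ℂ (L2 (Torus ν × Torus ν)) where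
  carrier := {f | (fun x => f x.swap) =ᵐ[volume] f}
  zero_mem' := by
    have h0 := Lp.coeFn_zero ℂ 2 (volume : Measure (Torus ν × Torus ν))
    have hs := (Measure.measurePreserving_swap (μ := (volume : Measure (Torus ν)))
      (ν := (volume : Measure (Torus ν)))).quasiMeasurePreserving.ae h0
    filter_upwards [h0, hs] with x h1 h2
    rw [h1, h2]
    rfl
  add_mem' := fun {f g} hf hg => by
    change (fun x => (f + g) x.swap) =ᵐ[volume] (f + g)
    have h0 := Lp.coeFn_add f g
    have hs := (Measure.measurePreserving_swap (μ := (volume : Measure (Torus ν)))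
      (ν := (volume : Measure (Torus ν)))).quasiMeasurePreserving.ae h0
    filter_upwards [h0, hs, hf, hg] with x h1 h2 h3 h4
    rw [h1, h2, Pi.add_apply, Pi.add_apply, h3, h4]
  smul_mem' := fun c f hf => by
    change (fun x => (c • f) x.swap) =ᵐ[volume] (c • f)
    have h0 := Lp.coeFn_smul c f
    have hs := (Measure.measurePreserving_swap (μ := (volume : Measure (Torus ν)))
      (ν := (volume : Measure (Torus ν)))).quasiMeasurePreserving.ae h0
    filter_upwards [h0, hs, hf] with x h1 h2 h3
    rw [h1, h2, Pi.smul_apply, Pi.smul_apply, h3]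

/-- The three-particle cut subspace of the Fock space, `ℂ ⊕ L²(𝕋) ⊕ L²ₛ(𝕋²)`, a Hilbert sum. -/
abbrev FockSpace (ν : ℕ) : Type :=
  WithLp 2 (ℂ × WithLp 2 (L2 (Torus ν) × symmL2 ν))

/-- The space `L²(𝕋) ⊕ L²(𝕋²)` of the channel operator. -/
abbrev ChannelSpace (ν : ℕ) : Type :=
  WithLp 2 (L2 (Torus ν) × L2 (Torus ν × Torus ν))

/-- The space `ℂ ⊕ L²(𝕋)` of the fiber operators. -/
abbrev FiberSpace (ν : ℕ) : Type := WithLp 2 (ℂ × L2 (Torus ν))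

/-- The operator on a Hilbert sum with matrix `(a b; c d)`. -/
def blockOp {E F : Type*} [NormedAddCommGroup E] [NormedSpace ℂ E] [NormedAddCommGroup F]
    [NormedSpace ℂ F] (a : E →L[ℂ] E) (b : F →L[ℂ] E) (c : E →L[ℂ] F) (d : F →L[ℂ] F) :
    WithLp 2 (E × F) →L[ℂ] WithLp 2 (E × F) :=
  (WithLp.prodContinuousLinearEquiv 2 ℂ E F).symm ∘L
    ((a.coprod b).prod (c.coprod d)) ∘L
    (WithLp.prodContinuousLinearEquiv 2 ℂ E F : WithLp 2 (E × F) →L[ℂ] E × F)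

/-! ### The coordinate maps that occur in the partial integral operators -/

theorem volume_torus_smul {Y : Type*} [MeasurableSpace Y] (μ : Measure Y) :
    (volume (Set.univ : Set (Torus ν)) • μ : Measure Y)
      = ((volume (Set.univ : Set (Torus ν))).toNNReal • μ : Measure Y) := by
  change _ = (((volume (Set.univ : Set (Torus ν))).toNNReal : ℝ≥0∞)) • μ
  rw [ENNReal.coe_toNNReal (measure_ne_top _ _)]

theorem bp_id {X : Type*} [MeasureSpace X] : BoundedPullback (fun x : X => x) :=
  ⟨measurable_id, 1, by simp [Measure.map_id']⟩

theorem bp_fst : BoundedPullback (fun x : Torus ν × Torus ν => x.1) :=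
  ⟨measurable_fst, _, ((Measure.map_fst_prod (μ := (volume : Measure (Torus ν)))
    (ν := (volume : Measure (Torus ν)))).trans (volume_torus_smul _)).le⟩

theorem bp_snd : BoundedPullback (fun x : Torus ν × Torus ν => x.2) :=
  ⟨measurable_snd, _, ((Measure.map_snd_prod (μ := (volume : Measure (Torus ν)))
    (ν := (volume : Measure (Torus ν)))).trans (volume_torus_smul _)).le⟩

theorem bp_fst_last :
    BoundedPullback (fun x : (Torus ν × Torus ν) × Torus ν => (x.1.1, x.2)) := by
  refine ⟨by fun_prop, (volume (Set.univ : Set (Torus ν))).toNNReal, le_of_eq ?_⟩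
  rw [← volume_torus_smul]
  have h := Measure.map_prod_map (volume : Measure (Torus ν × Torus ν))
    (volume : Measure (Torus ν)) measurable_fst measurable_id
  have h1 : Measure.map Prod.fst (volume : Measure (Torus ν × Torus ν)) = _ :=
    Measure.map_fst_prod (μ := (volume : Measure (Torus ν))) (ν := (volume : Measure (Torus ν)))
  rw [h1, Measure.map_id, Measure.prod_smul_left] at h
  exact h.symm

theorem bp_last_snd :
    BoundedPullback (fun x : (Torus ν × Torus ν) × Torus ν => (x.2, x.1.2)) := by
  refine ⟨by fun_prop, (volume (Set.univ : Set (Torus ν))).toNNReal, le_of_eq ?_⟩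
  rw [← volume_torus_smul]
  have h := Measure.map_prod_map (volume : Measure (Torus ν × Torus ν))
    (volume : Measure (Torus ν)) measurable_snd measurable_id
  have h1 : Measure.map Prod.snd (volume : Measure (Torus ν × Torus ν)) = _ :=
    Measure.map_snd_prod (μ := (volume : Measure (Torus ν))) (ν := (volume : Measure (Torus ν)))
  rw [h1, Measure.map_id, Measure.prod_smul_left] at h
  have h2 : (fun x : (Torus ν × Torus ν) × Torus ν => (x.2, x.1.2))
      = Prod.swap ∘ Prod.map Prod.snd id := rfl
  have h3 : Measure.map Prod.swap (volume : Measure (Torus ν × Torus ν)) = volume :=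
    Measure.prod_swap (μ := (volume : Measure (Torus ν))) (ν := (volume : Measure (Torus ν)))
  rw [h2, ← Measure.map_map measurable_swap (by fun_prop)]
  refine (congrArg (Measure.map Prod.swap) h.symm).trans ?_
  rw [Measure.map_smul]
  exact congrArg _ h3

/-! ### The model -/

/-- The parameters of the model: a real number `w₀`, real continuous functions `w₁, v₀, v₁` on the
torus and real continuous symmetric functions `w₂, v₂` on its square. -/
structure Parameters (ν : ℕ) where
  w₀ : ℝ
  w₁ : C(Torus ν, ℝ)
  v₀ : C(Torus ν, ℝ)
  v₁ : C(Torus ν, ℝ)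
  w₂ : C(Torus ν × Torus ν, ℝ)
  v₂ : C(Torus ν × Torus ν, ℝ)
  w₂_symm : ∀ p q, w₂ (p, q) = w₂ (q, p)
  v₂_symm : ∀ p q, v₂ (p, q) = v₂ (q, p)

namespace Parameters

variable (P : Parameters ν)

/-- `(V₁ f)(p, q) = ∫ v₂(p, s) f(s, q) ds` on `L²(𝕋²)`. -/
def V₁ : L2 (Torus ν × Torus ν) →L[ℂ] L2 (Torus ν × Torus ν) :=
  partialIntegral (fun x : (Torus ν × Torus ν) × Torus ν => P.v₂ (x.1.1, x.2)) (by fun_prop)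
    (fun x => (x.2, x.1.2)) bp_last_snd

/-- `(V₂ f)(p, q) = ∫ v₂(s, q) f(p, s) ds` on `L²(𝕋²)`. -/
def V₂ : L2 (Torus ν × Torus ν) →L[ℂ] L2 (Torus ν × Torus ν) :=
  partialIntegral (fun x : (Torus ν × Torus ν) × Torus ν => P.v₂ (x.2, x.1.2)) (by fun_prop)
    (fun x => (x.1.1, x.2)) bp_fst_last

/-- Multiplication by `w₂` on `L²(𝕋²)`. -/
def H₂₂free : L2 (Torus ν × Torus ν) →L[ℂ] L2 (Torus ν × Torus ν) :=
  weightedComp (fun x => P.w₂ x) (by fun_prop) (fun x => x) bp_id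

/-- `H₀₀ f₀ = w₀ f₀`. -/
def H₀₀ : ℂ →L[ℂ] ℂ := (P.w₀ : ℂ) • ContinuousLinearMap.id ℂ ℂ

/-- `H₀₁ f₁ = ∫ v₀(s) f₁(s) ds`. -/
def H₀₁ : L2 (Torus ν) →L[ℂ] ℂ := functional (fun s => P.v₀ s) (by fun_prop)

/-- `(H₁₀ f₀)(p) = v₀(p) f₀`. -/
def H₁₀ : ℂ →L[ℂ] L2 (Torus ν) := creation (fun p => P.v₀ p) (by fun_prop)

/-- `(H₁₁ f₁)(p) = w₁(p) f₁(p)`. -/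
def H₁₁ : L2 (Torus ν) →L[ℂ] L2 (Torus ν) :=
  weightedComp (fun p => P.w₁ p) (by fun_prop) (fun p => p) bp_id

/-- `(H₁₂ f₂)(p) = ∫ v₁(s) f₂(p, s) ds`, on all of `L²(𝕋²)`. -/
def H₁₂ : L2 (Torus ν × Torus ν) →L[ℂ] L2 (Torus ν) :=
  partialIntegral (fun x : Torus ν × Torus ν => P.v₁ x.2) (by fun_prop) (fun x => x) bp_id

/-- `(H₂₁⁽¹⁾ f₁)(p, q) = v₁(q) f₁(p)`. -/
def H₂₁left : L2 (Torus ν) →L[ℂ] L2 (Torus ν × Torus ν) :=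
  weightedComp (fun x => P.v₁ x.2) (by fun_prop) (fun x => x.1) bp_fst

/-- `(p, q) ↦ v₁(p) f₁(q)`. -/
def H₂₁right : L2 (Torus ν) →L[ℂ] L2 (Torus ν × Torus ν) :=
  weightedComp (fun x => P.v₁ x.1) (by fun_prop) (fun x => x.2) bp_snd

theorem swap_ae {Q : Torus ν × Torus ν → Prop} (h : ∀ᵐ x, Q x) :
    ∀ᵐ x : Torus ν × Torus ν, Q x.swap :=
  (Measure.measurePreserving_swap (μ := (volume : Measure (Torus ν)))
    (ν := (volume : Measure (Torus ν)))).quasiMeasurePreserving.ae h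

theorem H₂₁_mem (f : L2 (Torus ν)) :
    ((1 / 2 : ℂ) • (P.H₂₁right + P.H₂₁left)) f ∈ symmL2 ν := by
  have hr : P.H₂₁right f =ᵐ[volume] fun x => (P.v₁ x.1 : ℂ) * f x.2 :=
    coeFn_weightedComp _ _ _ _ f
  have hl : P.H₂₁left f =ᵐ[volume] fun x => (P.v₁ x.2 : ℂ) * f x.1 :=
    coeFn_weightedComp _ _ _ _ f
  refine Submodule.smul_mem _ _ ?_
  change (fun x => (P.H₂₁right f + P.H₂₁left f) x.swap) =ᵐ[volume] (P.H₂₁right f + P.H₂₁left f)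
  have ha := Lp.coeFn_add (P.H₂₁right f) (P.H₂₁left f)
  filter_upwards [ha, swap_ae ha, hr, swap_ae hr, hl, swap_ae hl] with x h1 h2 h3 h4 h5 h6
  rw [h1, h2, Pi.add_apply, Pi.add_apply, h3, h4, h5, h6, add_comm]
  rfl

/-- `(H₂₁ f₁)(p, q) = ½ (v₁(p) f₁(q) + v₁(q) f₁(p))`, a symmetric function. -/
def H₂₁ : L2 (Torus ν) →L[ℂ] symmL2 ν :=
  ((1 / 2 : ℂ) • (P.H₂₁right + P.H₂₁left)).codRestrict (symmL2 ν) P.H₂₁_mem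

theorem H₂₂_mem (f : symmL2 ν) :
    ((P.H₂₂free - P.V₁ - P.V₂) ∘L (symmL2 ν).subtypeL) f ∈ symmL2 ν := by
  obtain ⟨f, hf⟩ := f
  change (P.H₂₂free f - P.V₁ f - P.V₂ f) ∈ symmL2 ν
  have hf' : (fun x => f x.swap) =ᵐ[volume] f := hf
  have h0 : P.H₂₂free f =ᵐ[volume] fun x => (P.w₂ x : ℂ) * f x :=
    coeFn_weightedComp _ _ _ _ f
  have h1 : P.V₁ f =ᵐ[volume] fun x => ∫ s : Torus ν, (P.v₂ (x.1, s) : ℂ) * f (s, x.2) :=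
    coeFn_partialIntegral _ _ _ _ f
  have h2 : P.V₂ f =ᵐ[volume] fun x => ∫ s : Torus ν, (P.v₂ (s, x.2) : ℂ) * f (x.1, s) :=
    coeFn_partialIntegral _ _ _ _ f
  have key : (fun x => (P.V₁ f) x.swap) =ᵐ[volume] P.V₂ f := by
    have hs : ∀ᵐ x : Torus ν × Torus ν, ∀ᵐ s : Torus ν, f (s, x.1) = f (x.1, s) := by
      have := Measure.ae_ae_of_ae_prod (μ := (volume : Measure (Torus ν)))
        (ν := (volume : Measure (Torus ν))) hf'
      exact (bp_fst (ν := ν)).qmp.ae this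
    filter_upwards [swap_ae h1, h2, hs] with x h3 h4 h5
    rw [h3, h4]
    refine integral_congr_ae ?_
    filter_upwards [h5] with s h6
    simp only [Prod.fst_swap, Prod.snd_swap]
    rw [h6, P.v₂_symm]
  have ha := Lp.coeFn_sub (P.H₂₂free f) (P.V₁ f)
  have hb := Lp.coeFn_sub (P.H₂₂free f - P.V₁ f) (P.V₂ f)
  change (fun x => (P.H₂₂free f - P.V₁ f - P.V₂ f) x.swap) =ᵐ[volume]
    (P.H₂₂free f - P.V₁ f - P.V₂ f)
  filter_upwards [ha, swap_ae ha, hb, swap_ae hb, key, swap_ae key, h0, swap_ae h0, hf'] with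
    x a1 a2 b1 b2 k1 k2 z1 z2 hx
  rw [b1, b2, Pi.sub_apply, Pi.sub_apply, a1, a2, Pi.sub_apply, Pi.sub_apply, k1, ← k2, z1, z2,
    hx, Prod.swap_swap, sub_right_comm]
  have : P.w₂ x.swap = P.w₂ x := P.w₂_symm x.2 x.1
  rw [this]

/-- `H₂₂ = H₂₂⁰ - V₁ - V₂`, on symmetric functions. -/
def H₂₂ : symmL2 ν →L[ℂ] symmL2 ν :=
  ((P.H₂₂free - P.V₁ - P.V₂) ∘L (symmL2 ν).subtypeL).codRestrict (symmL2 ν) P.H₂₂_mem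

/-- The model operator, with matrix `(H₀₀ H₀₁ 0; H₁₀ H₁₁ H₁₂; 0 H₂₁ H₂₂)`. -/
def H : FockSpace ν →L[ℂ] FockSpace ν :=
  blockOp P.H₀₀
    (P.H₀₁ ∘L WithLp.fstL 2 ℂ (L2 (Torus ν)) (symmL2 ν))
    ((WithLp.prodContinuousLinearEquiv 2 ℂ (L2 (Torus ν)) (symmL2 ν)).symm.toContinuousLinearMap ∘L
      P.H₁₀.prod 0)
    (blockOp P.H₁₁ (P.H₁₂ ∘L (symmL2 ν).subtypeL) P.H₂₁ P.H₂₂)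

/-- The channel operator, with matrix `(H₁₁ 2^{-1/2}H₁₂; 2^{-1/2}H₂₁⁽¹⁾ H₂₂⁰-V₂)`. -/
def channel : ChannelSpace ν →L[ℂ] ChannelSpace ν :=
  blockOp P.H₁₁ (((1 / √2 : ℝ) : ℂ) • P.H₁₂) (((1 / √2 : ℝ) : ℂ) • P.H₂₁left)
    (P.H₂₂free - P.V₂)

/-- `(v f)(q) = ∫ v₂(q, s) f(s) ds` on `L²(𝕋)`. -/
def v : L2 (Torus ν) →L[ℂ] L2 (Torus ν) :=
  partialIntegral (fun x : Torus ν × Torus ν => P.v₂ x) (by fun_prop) (fun x => x.2) bp_snd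

/-- The fiber operator `h(p)`, with matrix `(h₀₀(p) h₀₁; h₁₀ h₁₁⁰(p)-v)`, where
`h₀₀(p) f₀ = w₁(p) f₀`, `h₀₁ f₁ = 2^{-1/2} ∫ v₁(s) f₁(s) ds`, `(h₁₀ f₀)(q) = 2^{-1/2} v₁(q) f₀` and
`(h₁₁⁰(p) f₁)(q) = w₂(p, q) f₁(q)`. -/
def fiber (p : Torus ν) : FiberSpace ν →L[ℂ] FiberSpace ν :=
  blockOp ((P.w₁ p : ℂ) • ContinuousLinearMap.id ℂ ℂ)
    (((1 / √2 : ℝ) : ℂ) • functional (fun s => P.v₁ s) (by fun_prop))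
    (((1 / √2 : ℝ) : ℂ) • creation (fun q => P.v₁ q) (by fun_prop))
    (weightedComp (fun q => P.w₂ (p, q)) (by fun_prop) (fun q => q) bp_id - P.v)

/-- The minimum of `w₂`. -/
def m : ℝ := ⨅ x, P.w₂ x

/-- The maximum of `w₂`. -/
def M : ℝ := ⨆ x, P.w₂ x

end Parameters

end FockModel

end

/-! The three sets are linked by a cycle of inclusions: the spectrum of the channel operator lies in
the union of the spectra of the fibers `h(p)`, each of these lies both in the essential spectrum of
`H` and in the channel spectrum, and the essential spectrum of `H` lies in the channel spectrum.
Throughout, essential spectrum is detected by Weyl's criterion: weakly null approximate eigenvectors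
bounded away from zero.

Channel inside fibers (`spectrum_channel_subset`): the channel operator acts on almost every section
over `p` as `h(p)`. If `z` avoids all fiber spectra, then `h(p) - z` is bounded below uniformly in
`p`, by norm continuity and compactness of the torus, and integrating over `p` bounds the channel
operator minus `z` below.

Fibers inside `H` (`spectrum_fiber_subset_essentialSpectrum_H`): multiply an approximate eigenvector
of `h(p₀)` by weakly null unit vectors `χₙ` concentrating at `p₀`, then symmetrize in the
two-particle component. What `H` adds to the channel operator (`H₀₁`, `V₁` and the flipped part of
`H₁₂`) tends to zero on these vectors, because it applies a continuous functional or an integral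
operator to `χₙ`.

`H` inside channel (`essentialSpectrum_H_subset`): let `z` lie outside the channel spectrum. The
range of `w₂` lies in that spectrum, so multiplication by `w₂ - z` has a bounded inverse `R`. For a
Weyl sequence with components `f₀, f₁, f₂`, subtract from `f₂` the correction `R g`, where `g`
collects the terms of `H` absent from the channel operator. `H₁₂ R` and `V₂ R` send `g` to zero in
norm, since integrating in both variables produces continuous kernels. Invertibility of the channel
operator minus `z` and the symmetry of `f₂` then force the whole sequence to zero, a contradiction.

Finally, the essential spectrum of `h(p)` lies in the range of `w₂(p, ·)`, which lies in the
spectrum of `h(p)`. The range of `w₂` is `[m, M]` by connectedness, so the union of the fiber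
spectra takes the stated form. -/

noncomputable section

namespace FockModel

/-! ### Weakly null sequences and Weyl's criterion -/

section Weyl

variable {E F : Type*} [NormedAddCommGroup E] [InnerProductSpace ℂ E]
  [NormedAddCommGroup F] [InnerProductSpace ℂ F]

/-- A bounded sequence that converges weakly to zero. -/
def WeaklyNull (u : ℕ → E) : Prop :=
  (∃ C, ∀ n, ‖u n‖ ≤ C) ∧ ∀ y, Tendsto (fun n => inner ℂ y (u n)) atTop (𝓝 0)

theorem WeaklyNull.map [CompleteSpace E] [CompleteSpace F] {u : ℕ → E} (hu : WeaklyNull u)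
    (T : E →L[ℂ] F) : WeaklyNull (fun n => T (u n)) := by
  obtain ⟨⟨C, hC⟩, h⟩ := hu
  refine ⟨⟨‖T‖ * C, fun n => (T.le_opNorm _).trans (by gcongr; exact hC n)⟩, fun y => ?_⟩
  simpa only [ContinuousLinearMap.adjoint_inner_left] using h (T.adjoint y)

theorem WeaklyNull.tendsto_zero [FiniteDimensional ℂ E] {u : ℕ → E} (hu : WeaklyNull u) :
    Tendsto u atTop (𝓝 0) := by
  let b := stdOrthonormalBasis ℂ E
  have h : Tendsto (fun n => ∑ i, inner ℂ (b i) (u n) • b i) atTop (𝓝 (∑ i, (0 : ℂ) • b i)) :=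
    tendsto_finsetSum _ fun i _ => (hu.2 (b i)).smul_const _
  simpa [b.sum_repr'] using h

/-- By Bessel's inequality the squared coefficients of any fixed vector are summable, hence tend to
zero. -/
theorem _root_.Orthonormal.weaklyNull {u : ℕ → E} (hu : Orthonormal ℂ u) : WeaklyNull u := by
  refine ⟨⟨1, fun n => (hu.1 n).le⟩, fun y => ?_⟩
  have h := (hu.inner_products_summable y).tendsto_atTop_zero
  rw [tendsto_zero_iff_norm_tendsto_zero]
  have h2 := h.sqrt
  simpa [Real.sqrt_sq (norm_nonneg _), norm_inner_symm] using h2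

theorem exists_orthonormal_sequence (h : ¬ FiniteDimensional ℂ E) :
    ∃ u : ℕ → E, Orthonormal ℂ u := by
  let b := Module.Basis.ofVectorSpace ℂ E
  have : Infinite (Module.Basis.ofVectorSpaceIndex ℂ E) := by
    by_contra hf
    rw [not_infinite_iff_finite] at hf
    exact h (Module.Finite.of_basis b)
  have hl : LinearIndependent ℂ (b ∘ Infinite.natEmbedding _) :=
    b.linearIndependent.comp _ (Infinite.natEmbedding _).injective
  exact ⟨_, InnerProductSpace.gramSchmidtNormed_orthonormal hl⟩

variable {A : E →L[ℂ] E}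

theorem bddBelow_of_notMem_spectrum {z : ℂ} (hz : z ∉ spectrum ℂ A) :
    ∃ c > 0, ∀ x, c * ‖x‖ ≤ ‖A x - z • x‖ := by
  rw [spectrum.notMem_iff, ← IsUnit.sub_iff] at hz
  obtain ⟨B, hB⟩ := hz.exists_left_inv
  -- The added 1 keeps the constant positive when `B = 0`, which happens on the zero space.
  refine ⟨(‖B‖ + 1)⁻¹, by positivity, fun x => ?_⟩
  rw [inv_mul_le_iff₀ (by positivity)]
  have h1 : B (A x - z • x) = x := by
    have := congrArg (fun T : E →L[ℂ] E => T x) hB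
    simpa [Algebra.algebraMap_eq_smul_one] using this
  calc ‖x‖ = ‖B (A x - z • x)‖ := by rw [h1]
    _ ≤ ‖B‖ * ‖A x - z • x‖ := B.le_opNorm _
    _ ≤ _ := by gcongr; linarith

theorem mem_spectrum_of_approx {z : ℂ} (h : ∀ ε > 0, ∃ x : ℕ → E, (∀ n, 1 ≤ ‖x n‖) ∧
    ∀ᶠ n in atTop, ‖A (x n) - z • x n‖ ≤ ε) : z ∈ spectrum ℂ A := by
  by_contra hz
  obtain ⟨c, hc, hb⟩ := bddBelow_of_notMem_spectrum hz
  obtain ⟨x, hx1, hx2⟩ := h (c / 2) (by positivity)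
  obtain ⟨n, hn⟩ := hx2.exists
  have := hb (x n)
  nlinarith [hx1 n]

variable [CompleteSpace E]

/-- A spectral point would be real, making `A - z` self-adjoint. Its range is then dense, being
orthogonal only to a kernel that the lower bound makes trivial; the same bound closes the range. -/
theorem notMem_spectrum_of_bddBelow (hA : IsSelfAdjoint A) {z : ℂ} {c : ℝ} (hc : 0 < c)
    (h : ∀ x, c * ‖x‖ ≤ ‖A x - z • x‖) : z ∉ spectrum ℂ A := by
  intro hz
  have hre := hA.mem_spectrum_eq_re hz
  set B : E →L[ℂ] E := A - z • 1 with hB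
  have hBx : ∀ x, B x = A x - z • x := fun x => by simp [hB]
  have hBs : IsSelfAdjoint B := by
    refine hA.sub (IsSelfAdjoint.smul ?_ (IsSelfAdjoint.one _))
    rw [hre]
    exact Complex.conj_ofReal _
  have hu : IsUnit B := by
    rw [ContinuousLinearMap.isUnit_iff_bijective,
      ContinuousLinearMap.bijective_iff_dense_range_and_antilipschitz]
    refine ⟨?_, c⁻¹.toNNReal, B.antilipschitz_of_bound fun x => ?_⟩
    · rw [Submodule.topologicalClosure_eq_top_iff, ContinuousLinearMap.orthogonal_range,
        hBs.adjoint_eq, Submodule.eq_bot_iff]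
      intro x hx
      have h1 := h x
      rw [← hBx, show B x = 0 from LinearMap.mem_ker.1 hx, norm_zero] at h1
      exact norm_le_zero_iff.1 (nonpos_of_mul_nonpos_right h1 hc)
    · rw [Real.coe_toNNReal _ (inv_nonneg.2 hc.le), hBx, le_inv_mul_iff₀ hc]
      exact h x
  refine hz ?_
  rw [spectrum.mem_resolventSet_iff, ← IsUnit.sub_iff]
  simpa [hB, Algebra.algebraMap_eq_smul_one] using hu

theorem eq_re_of_mem_essentialSpectrum (hA : IsSelfAdjoint A) {z : ℂ}
    (hz : z ∈ essentialSpectrum A) : z = z.re :=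
  hA.mem_spectrum_eq_re hz.1

theorem exists_unit_of_mem_spectrum (hA : IsSelfAdjoint A) {z : ℂ} (hz : z ∈ spectrum ℂ A)
    {ε : ℝ} (hε : 0 < ε) : ∃ x, ‖x‖ = 1 ∧ ‖A x - z • x‖ < ε := by
  by_contra! hcon
  refine notMem_spectrum_of_bddBelow hA hε (fun x => ?_) hz
  by_cases hx : x = 0
  · simp [hx]
  have hx0 : ‖x‖ ≠ 0 := norm_ne_zero_iff.2 hx
  have h1 := hcon (((‖x‖⁻¹ : ℝ) : ℂ) • x) (by simp [norm_smul, hx0])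
  rw [map_smul, smul_comm, ← smul_sub, norm_smul] at h1
  simp only [Complex.norm_real, norm_inv, norm_norm] at h1
  rwa [le_inv_mul_iff₀ (by positivity), mul_comm] at h1

/-- `G` is the reduced resolvent, obtained by functional calculus from `(x - z)⁻¹` with value 0 at
`z`; isolation makes this function continuous on the spectrum. `Q` is the complementary projection
onto the eigenspace. -/
theorem exists_parametrix_of_isolated (hA : IsSelfAdjoint A) {z : ℂ}
    (hz : ∀ᶠ w in 𝓝[≠] z, w ∉ spectrum ℂ A) :
    ∃ G Q : E →L[ℂ] E, (A - z • 1) * Q = 0 ∧ G * (A - z • 1) + Q = 1 := by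
  have hcont : ContinuousOn (fun x : ℂ => (x - z)⁻¹) (spectrum ℂ A) := by
    intro x hx
    by_cases hxz : x = z
    · subst hxz
      have hs : 𝓝[spectrum ℂ A] x ≤ pure x := by
        rw [eventually_nhdsWithin_iff] at hz
        rw [Filter.le_pure_iff, mem_nhdsWithin_iff_eventually]
        filter_upwards [hz] with w hw hwA
        by_contra hne
        exact hw hne hwA
      exact (tendsto_pure_nhds _ _).mono_left hs
    · exact ((continuousAt_id.sub continuousAt_const).inv₀ (sub_ne_zero.2 hxz)).continuousWithinAt
  have hn : IsStarNormal A := hA.isStarNormal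
  have hsub : cfc (fun x : ℂ => x - z) A = A - z • 1 := by
    rw [cfc_sub (fun x : ℂ => x) (fun _ => z) A, cfc_id' ℂ A, cfc_const z A,
      Algebra.algebraMap_eq_smul_one]
  set G := cfc (fun x : ℂ => (x - z)⁻¹) A with hG
  refine ⟨G, 1 - G * (A - z • 1), ?_, by simp⟩
  have h3 : (A - z • 1) * (G * (A - z • 1)) = A - z • 1 := by
    rw [← hsub, hG, ← cfc_mul _ _ A, ← cfc_mul _ _ A]
    refine cfc_congr fun x _ => ?_
    by_cases hx : x - z = 0
    · simp [hx]
    · field_simp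
  rw [mul_sub, mul_one, h3, sub_self]

/-- If `z` were discrete, `Q` would have finite-dimensional range and send `u` to zero in norm,
leaving `u` close to `G (A - z) u`, which is small. Allowing a different sequence for each `ε`
avoids diagonal arguments later. -/
theorem mem_essentialSpectrum_of_weaklyNull (hA : IsSelfAdjoint A) {z : ℂ}
    (h : ∀ ε > 0, ∃ u : ℕ → E, WeaklyNull u ∧ (∀ n, 1 ≤ ‖u n‖) ∧
      ∀ᶠ n in atTop, ‖A (u n) - z • u n‖ ≤ ε) : z ∈ essentialSpectrum A := by
  refine ⟨mem_spectrum_of_approx fun ε hε => (h ε hε).imp fun u hu => hu.2, ?_⟩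
  rintro ⟨-, hiso, -, hfin⟩
  obtain ⟨G, Q, hQ, hGQ⟩ := exists_parametrix_of_isolated hA hiso
  obtain ⟨u, hu, hu1, hu2⟩ := h (2 * (‖G‖ + 1))⁻¹ (by positivity)
  have hmem : ∀ x, Q x ∈ Module.End.eigenspace (A : E →ₗ[ℂ] E) z := fun x => by
    rw [Module.End.mem_eigenspace_iff]
    have := congrArg (fun T : E →L[ℂ] E => T x) hQ
    simpa [sub_eq_zero] using this
  have hQu : Tendsto (fun n => ‖Q (u n)‖) atTop (𝓝 0) := by
    have := (hu.map (Q.codRestrict _ hmem)).tendsto_zero.norm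
    simpa using this
  obtain ⟨n, hn1, hn2⟩ :=
    (hu2.and (hQu.eventually_lt_const (show (0 : ℝ) < 1 / 2 by norm_num))).exists
  have hid : u n = G (A (u n) - z • u n) + Q (u n) := by
    have := congrArg (fun T : E →L[ℂ] E => T (u n)) hGQ
    simpa using this.symm
  have h1 : ‖u n‖ ≤ ‖G‖ * ‖A (u n) - z • u n‖ + ‖Q (u n)‖ := by
    conv_lhs => rw [hid]
    exact (norm_add_le _ _).trans (by gcongr; exact G.le_opNorm _)
  have h2 : ‖G‖ * ‖A (u n) - z • u n‖ ≤ 1 / 2 := by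
    calc ‖G‖ * ‖A (u n) - z • u n‖ ≤ (‖G‖ + 1) * (2 * (‖G‖ + 1))⁻¹ := by gcongr; linarith
      _ = 1 / 2 := by field_simp
  linarith [hu1 n]

/-- The orthogonal complement of the kernel of `B = A - z` is the closure of the range of `B`, and
against a vector `B x` the inner product is that of `x` with `B (u n)`, which tends to zero. -/
theorem tendsto_inner_zero_of_orthogonal_eigenspace (hA : IsSelfAdjoint A) {z : ℂ}
    (hre : z = z.re) {u : ℕ → E} (hu1 : ∀ n, ‖u n‖ = 1)
    (huN : ∀ n, u n ∈ (Module.End.eigenspace (A : E →ₗ[ℂ] E) z)ᗮ)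
    (hu : Tendsto (fun n => A (u n) - z • u n) atTop (𝓝 0)) (y : E) :
    Tendsto (fun n => inner ℂ y (u n)) atTop (𝓝 0) := by
  set N := Module.End.eigenspace (A : E →ₗ[ℂ] E) z with hN
  set B : E →L[ℂ] E := A - z • 1 with hB
  have hBs : IsSelfAdjoint B := by
    refine hA.sub (IsSelfAdjoint.smul ?_ (IsSelfAdjoint.one _))
    rw [hre]
    exact Complex.conj_ofReal _
  have hNB : N = B.ker := by
    ext x
    rw [hN, Module.End.mem_eigenspace_iff, LinearMap.mem_ker]
    simp [hB, sub_eq_zero]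
  have hNc : IsClosed (N : Set E) := hNB ▸ B.isClosed_ker
  have : CompleteSpace N := hNc.completeSpace_coe
  obtain ⟨a, ha, b, hb, rfl⟩ := N.exists_add_mem_mem_orthogonal y
  have h1 : ∀ n, inner ℂ (a + b) (u n) = inner ℂ b (u n) := fun n => by
    rw [inner_add_left, N.inner_right_of_mem_orthogonal ha (huN n), zero_add]
  simp only [h1]
  rw [hNB, ContinuousLinearMap.orthogonal_ker, hBs.adjoint_eq] at hb
  rw [Metric.tendsto_atTop]
  intro ε hε
  obtain ⟨w, ⟨x, rfl⟩, hw⟩ := Metric.mem_closure_iff.1 hb (ε / 2) (by positivity)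
  have hx : Tendsto (fun n => inner ℂ x (A (u n) - z • u n)) atTop (𝓝 (inner ℂ x 0)) :=
    tendsto_const_nhds.inner hu
  rw [inner_zero_right, Metric.tendsto_atTop] at hx
  obtain ⟨n₀, hn₀⟩ := hx (ε / 2) (by positivity)
  refine ⟨n₀, fun n hn => ?_⟩
  have h2 := hn₀ n hn
  rw [dist_zero_right] at h2 ⊢
  have h3 : inner ℂ b (u n) = inner ℂ (b - B x) (u n) + inner ℂ x (A (u n) - z • u n) := by
    have : A (u n) - z • u n = B (u n) := by simp [hB]
    rw [this, ← ContinuousLinearMap.adjoint_inner_left, hBs.adjoint_eq, inner_sub_left]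
    ring
  rw [h3]
  refine (norm_add_le _ _).trans_lt ?_
  have h4 : ‖inner ℂ (b - B x) (u n)‖ < ε / 2 := by
    refine (norm_inner_le_norm _ _).trans_lt ?_
    rw [hu1 n, mul_one, ← dist_eq_norm]
    exact hw
  linarith

theorem mem_discreteSpectrum_of_bddBelow (hA : IsSelfAdjoint A) {z : ℂ} (hz : z ∈ spectrum ℂ A)
    (hfin : FiniteDimensional ℂ (Module.End.eigenspace (A : E →ₗ[ℂ] E) z)) {c : ℝ} (hc : 0 < c)
    (h : ∀ x ∈ (Module.End.eigenspace (A : E →ₗ[ℂ] E) z)ᗮ, c * ‖x‖ ≤ ‖A x - z • x‖) :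
    z ∈ discreteSpectrum A := by
  set N := Module.End.eigenspace (A : E →ₗ[ℂ] E) z with hN
  have hAN : ∀ a ∈ N, A a = z • a := fun a ha => Module.End.mem_eigenspace_iff.1 ha
  have hperp : ∀ b ∈ Nᗮ, A b ∈ Nᗮ := fun b hb a ha => by
    rw [← ContinuousLinearMap.adjoint_inner_left, hA.adjoint_eq, hAN a ha, inner_smul_left,
      hb a ha, mul_zero]
  refine ⟨hz, ?_, ?_, hfin⟩
  · rw [eventually_nhdsWithin_iff]
    -- For `w` within `c / 2` of `z`, `A - w` is exactly `z - w` on the eigenspace and is bounded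
    -- below by `c - ‖z - w‖ ≥ ‖z - w‖` on its complement. Both subspaces are invariant, so `‖z -
    -- w‖` works globally.
    filter_upwards [Metric.ball_mem_nhds z (half_pos hc)] with w hw hne
    have hd : 0 < ‖z - w‖ := norm_pos_iff.2 (sub_ne_zero.2 (Ne.symm hne))
    have hw' : ‖z - w‖ < c / 2 := by rwa [← dist_eq_norm, dist_comm]
    refine notMem_spectrum_of_bddBelow hA hd fun x => ?_
    obtain ⟨a, ha, b, hb, rfl⟩ := N.exists_add_mem_mem_orthogonal x
    have h1 : A (a + b) - w • (a + b) = (z - w) • a + (A b - w • b) := by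
      rw [map_add, hAN a ha]; module
    have hab : A b - w • b ∈ Nᗮ := Submodule.sub_mem _ (hperp b hb) (Submodule.smul_mem _ _ hb)
    have h2 : ‖z - w‖ * ‖b‖ ≤ ‖A b - w • b‖ := by
      have h3 : A b - z • b = (A b - w • b) - (z - w) • b := by module
      have h4 := h b hb
      rw [h3] at h4
      have h5 := h4.trans (norm_sub_le _ _)
      rw [norm_smul] at h5
      nlinarith [norm_nonneg b]
    have e1 := norm_add_sq_eq_norm_sq_add_norm_sq_of_inner_eq_zero a b (hb a ha)
    have e2 := norm_add_sq_eq_norm_sq_add_norm_sq_of_inner_eq_zero ((z - w) • a) (A b - w • b)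
      (hab _ (N.smul_mem _ ha))
    rw [h1]
    refine le_of_sq_le_sq ?_ (norm_nonneg _)
    rw [norm_smul] at e2
    have h6 : (‖z - w‖ * ‖b‖) ^ 2 ≤ ‖A b - w • b‖ ^ 2 := by gcongr
    rw [mul_pow, sq ‖a + b‖, e1, sq ‖(z - w) • a + (A b - w • b)‖, e2]
    linarith
  · rw [Module.End.hasEigenvalue_iff]
    intro hbot
    refine notMem_spectrum_of_bddBelow hA hc (fun x => h x ?_) hz
    rw [hN, hbot]
    simp

/-- An infinite-dimensional eigenspace supplies an orthonormal sequence. If it is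
finite-dimensional, `A - z` cannot be bounded below on its complement, since otherwise `z` would be
discrete; approximate eigenvectors taken there are automatically weakly null. -/
theorem exists_weaklyNull_of_mem_essentialSpectrum (hA : IsSelfAdjoint A) {z : ℂ}
    (hz : z ∈ essentialSpectrum A) : ∃ u : ℕ → E, WeaklyNull u ∧ (∀ n, ‖u n‖ = 1) ∧
      Tendsto (fun n => A (u n) - z • u n) atTop (𝓝 0) := by
  obtain ⟨hz, hd⟩ := hz
  set N := Module.End.eigenspace (A : E →ₗ[ℂ] E) z with hN
  by_cases hfin : FiniteDimensional ℂ N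
  · have hex : ∀ n : ℕ, ∃ x ∈ Nᗮ, ‖x‖ = 1 ∧ ‖A x - z • x‖ < 1 / ((n : ℝ) + 1) := by
      intro n
      by_contra! hcon
      refine hd (mem_discreteSpectrum_of_bddBelow hA hz hfin
        (c := 1 / ((n : ℝ) + 1)) (by positivity) fun x hx => ?_)
      by_cases hx0 : x = 0
      · simp [hx0]
      have hx0 : ‖x‖ ≠ 0 := norm_ne_zero_iff.2 hx0
      have h1 := hcon (((‖x‖⁻¹ : ℝ) : ℂ) • x) (Submodule.smul_mem _ _ hx) (by simp [norm_smul, hx0])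
      rw [map_smul, smul_comm, ← smul_sub, norm_smul] at h1
      simp only [Complex.norm_real, norm_inv, norm_norm] at h1
      rwa [le_inv_mul_iff₀ (by positivity), mul_comm] at h1
    choose u huN hu1 hu using hex
    have hlim : Tendsto (fun n => A (u n) - z • u n) atTop (𝓝 0) :=
      squeeze_zero_norm (fun n => (hu n).le) tendsto_one_div_add_atTop_nhds_zero_nat
    exact ⟨u, ⟨⟨1, fun n => (hu1 n).le⟩, tendsto_inner_zero_of_orthogonal_eigenspace hA
      (hA.mem_spectrum_eq_re hz) hu1 huN hlim⟩, hu1, hlim⟩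
  · obtain ⟨u, hu⟩ := exists_orthonormal_sequence hfin
    have hu' : Orthonormal ℂ (fun n => (u n : E)) := hu.comp_linearIsometry N.subtypeₗᵢ
    refine ⟨fun n => u n, hu'.weaklyNull, hu'.1, ?_⟩
    have : ∀ n, A (u n) - z • (u n : E) = 0 := fun n =>
      sub_eq_zero.2 (Module.End.mem_eigenspace_iff.1 (u n).2)
    simp [this]

end Weyl

/-! ### Block operators -/

section Block

section Norm

variable {E F : Type*} [NormedAddCommGroup E] [NormedAddCommGroup F]

theorem norm_toLp_sq (x : E) (y : F) :
    ‖WithLp.toLp 2 (x, y)‖ ^ 2 = ‖x‖ ^ 2 + ‖y‖ ^ 2 :=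
  WithLp.prod_norm_sq_eq_of_L2 _

theorem norm_fst_le_norm (x : WithLp 2 (E × F)) : ‖x.fst‖ ≤ ‖x‖ :=
  le_of_sq_le_sq (by nlinarith [WithLp.prod_norm_sq_eq_of_L2 x, sq_nonneg ‖x.snd‖]) (norm_nonneg _)

theorem norm_snd_le_norm (x : WithLp 2 (E × F)) : ‖x.snd‖ ≤ ‖x‖ :=
  le_of_sq_le_sq (by nlinarith [WithLp.prod_norm_sq_eq_of_L2 x, sq_nonneg ‖x.fst‖]) (norm_nonneg _)

theorem norm_le_norm_fst_add_norm_snd (x : WithLp 2 (E × F)) : ‖x‖ ≤ ‖x.fst‖ + ‖x.snd‖ := by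
  have h1 := WithLp.prod_norm_sq_eq_of_L2 x
  have h2 := mul_nonneg (norm_nonneg x.fst) (norm_nonneg x.snd)
  exact le_of_sq_le_sq (by nlinarith) (by positivity)

end Norm

variable {E F : Type*} [NormedAddCommGroup E] [InnerProductSpace ℂ E]
  [NormedAddCommGroup F] [InnerProductSpace ℂ F]
  (a : E →L[ℂ] E) (b : F →L[ℂ] E) (c : E →L[ℂ] F) (d : F →L[ℂ] F)

@[simp]
theorem blockOp_fst (x : WithLp 2 (E × F)) : (blockOp a b c d x).fst = a x.fst + b x.snd := rfl

@[simp]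
theorem blockOp_snd (x : WithLp 2 (E × F)) : (blockOp a b c d x).snd = c x.fst + d x.snd := rfl

theorem isSelfAdjoint_blockOp [CompleteSpace E] [CompleteSpace F] {a : E →L[ℂ] E}
    {b : F →L[ℂ] E} {c : E →L[ℂ] F} {d : F →L[ℂ] F} (ha : IsSelfAdjoint a) (hd : IsSelfAdjoint d)
    (hbc : ∀ x y, inner ℂ (b y) x = inner ℂ y (c x)) : IsSelfAdjoint (blockOp a b c d) := by
  rw [ContinuousLinearMap.isSelfAdjoint_iff_isSymmetric] at ha hd ⊢
  intro x y
  have hcb : ∀ x y, inner ℂ (c x) y = inner ℂ x (b y) := fun x y => by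
    rw [← inner_conj_symm, ← hbc, inner_conj_symm]
  simp only [ContinuousLinearMap.coe_coe, WithLp.prod_inner_apply, WithLp.ofLp_fst,
    WithLp.ofLp_snd, blockOp_fst, blockOp_snd, inner_add_left, inner_add_right, hbc, hcb]
  rw [show inner ℂ (a x.fst) y.fst = inner ℂ x.fst (a y.fst) from ha _ _,
    show inner ℂ (d x.snd) y.snd = inner ℂ x.snd (d y.snd) from hd _ _]
  ring

end Block

/-! ### Operators on `L²` -/

section L2ops

variable {X Y : Type*} [MeasureSpace X] [MeasureSpace Y]

theorem norm_sq_eq_integral (f : L2 X) : ‖f‖ ^ 2 = ∫ x, ‖f x‖ ^ 2 := by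
  have h := inner_self_eq_norm_sq_to_K (𝕜 := ℂ) f
  rw [L2.inner_def] at h
  simp only [inner_self_eq_norm_sq_to_K] at h
  have h2 : ∫ x, ((‖f x‖ : ℂ)) ^ 2 = ((∫ x, ‖f x‖ ^ 2 : ℝ) : ℂ) := by
    rw [← integral_complex_ofReal]
    simp
  have h3 : ((‖f‖ ^ 2 : ℝ) : ℂ) = ((∫ x, ‖f x‖ ^ 2 : ℝ) : ℂ) := by
    rw [← h2]
    simpa using h.symm
  exact_mod_cast h3

theorem integrable_norm_sq (f : L2 X) : Integrable (fun x => ‖f x‖ ^ 2) :=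
  (Lp.memLp f).integrable_norm_pow (by norm_num)

variable [TopologicalSpace X] [CompactSpace X] [OpensMeasurableSpace X]

/-- Multiplication by a continuous function. -/
abbrev mulOp (k : X → ℝ) (hk : Continuous k) : L2 X →L[ℂ] L2 X :=
  weightedComp k hk (fun x => x) bp_id

theorem coeFn_mulOp (k : X → ℝ) (hk : Continuous k) (f : L2 X) :
    mulOp k hk f =ᵐ[volume] fun x => (k x : ℂ) * f x :=
  coeFn_weightedComp k hk _ bp_id f

theorem norm_mulOp_le (k : X → ℝ) (hk : Continuous k) {C : ℝ} {f : L2 X}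
    (h : ∀ᵐ x, f x ≠ 0 → |k x| ≤ C) : ‖mulOp k hk f‖ ≤ C * ‖f‖ := by
  refine Lp.norm_le_mul_norm_of_ae_le_mul ?_
  filter_upwards [h, coeFn_mulOp k hk f] with x hx hx'
  rw [hx', norm_mul, Complex.norm_real, Real.norm_eq_abs]
  by_cases h0 : f x = 0
  · simp [h0]
  · gcongr
    exact hx h0

theorem isSelfAdjoint_mulOp (k : X → ℝ) (hk : Continuous k) : IsSelfAdjoint (mulOp k hk) := by
  rw [ContinuousLinearMap.isSelfAdjoint_iff_isSymmetric]
  intro f g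
  change inner ℂ (mulOp k hk f) g = inner ℂ f (mulOp k hk g)
  rw [L2.inner_def, L2.inner_def]
  refine integral_congr_ae ?_
  filter_upwards [coeFn_mulOp k hk f, coeFn_mulOp k hk g] with x h1 h2
  rw [h1, h2]
  simp
  ring

theorem mulOp_mulOp (k l : X → ℝ) (hk : Continuous k) (hl : Continuous l) (f : L2 X) :
    mulOp k hk (mulOp l hl f) = mulOp (fun x => k x * l x) (hk.mul hl) f := by
  apply Lp.ext
  filter_upwards [coeFn_mulOp k hk (mulOp l hl f), coeFn_mulOp l hl f,
    coeFn_mulOp (fun x => k x * l x) (hk.mul hl) f] with x h1 h2 h3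
  rw [h1, h2, h3]
  push_cast
  ring

theorem mulOp_const (c : ℝ) (f : L2 X) : mulOp (fun _ => c) continuous_const f = (c : ℂ) • f := by
  apply Lp.ext
  filter_upwards [coeFn_mulOp (fun _ => c) continuous_const f, Lp.coeFn_smul (c : ℂ) f] with x h1 h2
  rw [h1, h2, Pi.smul_apply, smul_eq_mul]

theorem mulOp_sub (k l : X → ℝ) (hk : Continuous k) (hl : Continuous l) (f : L2 X) :
    mulOp (fun x => k x - l x) (hk.sub hl) f = mulOp k hk f - mulOp l hl f := by
  apply Lp.ext
  filter_upwards [coeFn_mulOp (fun x => k x - l x) (hk.sub hl) f, coeFn_mulOp k hk f,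
    coeFn_mulOp l hl f, Lp.coeFn_sub (mulOp k hk f) (mulOp l hl f)] with x h1 h2 h3 h4
  rw [h1, h4, Pi.sub_apply, h2, h3]
  push_cast
  ring

theorem mulOp_one (f : L2 X) : mulOp (fun _ => 1) continuous_const f = f := by
  rw [mulOp_const, Complex.ofReal_one, one_smul]

theorem mulOp_mulOp_inv {k : X → ℝ} (hk : Continuous k) (hne : ∀ x, k x ≠ 0) (f : L2 X) :
    mulOp k hk (mulOp (fun x => (k x)⁻¹) (hk.inv₀ hne) f) = f := by
  rw [mulOp_mulOp]
  simpa only [mul_inv_cancel₀ (hne _)] using mulOp_one f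

theorem mulOp_inv_mulOp {k : X → ℝ} (hk : Continuous k) (hne : ∀ x, k x ≠ 0) (f : L2 X) :
    mulOp (fun x => (k x)⁻¹) (hk.inv₀ hne) (mulOp k hk f) = f := by
  rw [mulOp_mulOp]
  simpa only [inv_mul_cancel₀ (hne _)] using mulOp_one f

variable [IsFiniteMeasure (volume : Measure X)]

theorem functional_apply (k : X → ℝ) (hk : Continuous k) (f : L2 X) :
    functional k hk f = ∫ x, (k x : ℂ) * f x := rfl

theorem functional_eq_inner (k : X → ℝ) (hk : Continuous k) (f : L2 X) :
    functional k hk f = inner ℂ ((memLp_continuous hk).toLp _) f :=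
  integral_mul_eq_inner hk f

theorem creation_apply (k : X → ℝ) (hk : Continuous k) (c : ℂ) :
    creation k hk c = c • (memLp_continuous hk).toLp (fun x => (k x : ℂ)) := rfl

theorem inner_functional (k : X → ℝ) (hk : Continuous k) (c : ℂ) (f : L2 X) :
    inner ℂ (functional k hk f) c = inner ℂ f (creation k hk c) := by
  rw [functional_eq_inner, creation_apply, inner_smul_right, ← inner_conj_symm f]
  simp

theorem WeaklyNull.tendsto_functional {k : X → ℝ} (hk : Continuous k) {u : ℕ → L2 X}
    (hu : WeaklyNull u) : Tendsto (fun n => functional k hk (u n)) atTop (𝓝 0) := by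
  simpa only [functional_eq_inner] using hu.2 ((memLp_continuous hk).toLp _)

end L2ops

section IntegralOp

variable {X Y : Type*} [MeasureSpace X] [MeasureSpace Y] [TopologicalSpace X] [CompactSpace X]
  [IsFiniteMeasure (volume : Measure X)] [TopologicalSpace Y] [CompactSpace Y]
  [OpensMeasurableSpace Y] [IsFiniteMeasure (volume : Measure Y)]

/-- An integral operator with continuous kernel maps weakly null sequences to null sequences. -/
theorem WeaklyNull.tendsto_integralOp {k : X × Y → ℝ}
    (hk : Continuous k) {K : L2 Y →L[ℂ] L2 X}
    (hK : ∀ f, K f =ᵐ[volume] fun x => ∫ y, (k (x, y) : ℂ) * f y) {u : ℕ → L2 Y}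
    (hu : WeaklyNull u) : Tendsto (fun n => K (u n)) atTop (𝓝 0) := by
  have hkx : ∀ x, Continuous fun y => k (x, y) := fun x => by fun_prop
  obtain ⟨C, hC⟩ := exists_bound hk
  obtain ⟨D, hD⟩ := hu.1
  set c : ℝ := C * Real.sqrt (volume.real (Set.univ : Set Y)) with hc
  -- The slices of the kernel are bounded in `L²` uniformly in `x`. Weak convergence gives pointwise
  -- convergence of `K (u n)`, and this bound dominates it on a finite measure space.
  have hn : ∀ x, ‖(memLp_continuous (hkx x)).toLp _‖ ≤ c := fun x => by
    refine le_of_sq_le_sq ?_ (by positivity)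
    rw [norm_sq_eq_integral, hc, mul_pow, Real.sq_sqrt (by positivity)]
    calc _ ≤ ∫ y : Y, (C : ℝ) ^ 2 := by
          refine integral_mono_ae (integrable_norm_sq _) (integrable_const _) ?_
          filter_upwards [(memLp_continuous (hkx x)).coeFn_toLp] with y hy
          rw [hy]
          have := hC (x, y)
          simp only [Complex.norm_real]
          gcongr
      _ = _ := by simp [mul_comm]
  rw [tendsto_zero_iff_norm_tendsto_zero]
  have hsq : Tendsto (fun n => ‖K (u n)‖ ^ 2) atTop (𝓝 0) := by
    have h1 : ∀ n, ‖K (u n)‖ ^ 2 = ∫ x, ‖functional _ (hkx x) (u n)‖ ^ 2 := fun n => by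
      rw [norm_sq_eq_integral]
      refine integral_congr_ae ?_
      filter_upwards [hK (u n)] with x hx
      rw [hx, functional_apply]
    have hae : ∀ n, (fun x => ‖functional _ (hkx x) (u n)‖ ^ 2) =ᵐ[volume]
        fun x => ‖K (u n) x‖ ^ 2 := fun n => by
      filter_upwards [hK (u n)] with x hx
      rw [hx, functional_apply]
    simp only [h1]
    have h0 : (0 : ℝ) = ∫ x : X, (0 : ℝ) := by simp
    rw [h0]
    refine tendsto_integral_of_dominated_convergence (fun _ => (c * D) ^ 2) (fun n => ?_)
      (integrable_const _) (fun n => ?_) ?_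
    · exact (integrable_norm_sq (K (u n))).aestronglyMeasurable.congr (hae n).symm
    · refine Eventually.of_forall fun x => ?_
      rw [Real.norm_of_nonneg (by positivity)]
      gcongr
      rw [functional_eq_inner]
      refine (norm_inner_le_norm _ _).trans ?_
      gcongr
      · exact hn x
      · exact hD n
    · refine Eventually.of_forall fun x => ?_
      have := ((hu.2 ((memLp_continuous (hkx x)).toLp _)).norm.pow 2)
      simpa [functional_eq_inner] using this
  simpa [Real.sqrt_sq (norm_nonneg _)] using hsq.sqrt

end IntegralOp

variable {ν : ℕ}

/-! ### The flip of the two variables -/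

/-- The flip `f ↦ ((p, q) ↦ f(q, p))` on `L²(𝕋²)`. -/
def flip : L2 (Torus ν × Torus ν) →ₗᵢ[ℂ] L2 (Torus ν × Torus ν) :=
  Lp.compMeasurePreservingₗᵢ ℂ Prod.swap Measure.measurePreserving_swap

theorem coeFn_flip (f : L2 (Torus ν × Torus ν)) : flip f =ᵐ[volume] fun x => f x.swap :=
  Lp.coeFn_compMeasurePreserving f Measure.measurePreserving_swap

theorem flip_flip (f : L2 (Torus ν × Torus ν)) : flip (flip f) = f := by
  apply Lp.ext
  filter_upwards [coeFn_flip (flip f), Parameters.swap_ae (coeFn_flip f)] with x h1 h2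
  rw [h1, h2, Prod.swap_swap]

theorem inner_flip (f g : L2 (Torus ν × Torus ν)) : inner ℂ (flip f) g = inner ℂ f (flip g) := by
  conv_lhs => rw [← flip_flip g]
  exact flip.inner_map_map f (flip g)

theorem mem_symmL2_iff {f : L2 (Torus ν × Torus ν)} : f ∈ symmL2 ν ↔ flip f = f := by
  refine ⟨fun h => Lp.ext ((coeFn_flip f).trans h), fun h => ?_⟩
  have := coeFn_flip f
  rw [h] at this
  exact this.symm

instance : CompleteSpace (symmL2 ν) := by
  have h : IsClosed (symmL2 ν : Set (L2 (Torus ν × Torus ν))) := by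
    have : (symmL2 ν : Set (L2 (Torus ν × Torus ν))) = {f | flip f = f} := by
      ext f
      exact mem_symmL2_iff
    rw [this]
    exact isClosed_eq flip.continuous continuous_id
  exact h.completeSpace_coe

namespace Parameters

variable (P : Parameters ν)

theorem coeFn_V₁ (f : L2 (Torus ν × Torus ν)) :
    P.V₁ f =ᵐ[volume] fun x => ∫ s : Torus ν, (P.v₂ (x.1, s) : ℂ) * f (s, x.2) :=
  coeFn_partialIntegral _ _ _ _ f

theorem coeFn_V₂ (f : L2 (Torus ν × Torus ν)) :
    P.V₂ f =ᵐ[volume] fun x => ∫ s : Torus ν, (P.v₂ (s, x.2) : ℂ) * f (x.1, s) :=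
  coeFn_partialIntegral _ _ _ _ f

theorem coeFn_H₂₂free (f : L2 (Torus ν × Torus ν)) :
    P.H₂₂free f =ᵐ[volume] fun x => (P.w₂ x : ℂ) * f x :=
  coeFn_weightedComp _ _ _ _ f

theorem coeFn_H₁₁ (f : L2 (Torus ν)) : P.H₁₁ f =ᵐ[volume] fun x => (P.w₁ x : ℂ) * f x :=
  coeFn_weightedComp _ _ _ _ f

theorem coeFn_H₁₂ (f : L2 (Torus ν × Torus ν)) :
    P.H₁₂ f =ᵐ[volume] fun x => ∫ s : Torus ν, (P.v₁ s : ℂ) * f (x, s) :=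
  coeFn_partialIntegral _ _ _ _ f

theorem coeFn_H₂₁left (f : L2 (Torus ν)) :
    P.H₂₁left f =ᵐ[volume] fun x => (P.v₁ x.2 : ℂ) * f x.1 :=
  coeFn_weightedComp _ _ _ _ f

theorem coeFn_H₂₁right (f : L2 (Torus ν)) :
    P.H₂₁right f =ᵐ[volume] fun x => (P.v₁ x.1 : ℂ) * f x.2 :=
  coeFn_weightedComp _ _ _ _ f

theorem coeFn_v (f : L2 (Torus ν)) :
    P.v f =ᵐ[volume] fun x => ∫ s : Torus ν, (P.v₂ (x, s) : ℂ) * f s :=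
  coeFn_partialIntegral _ _ _ _ f

theorem flip_V₁ (f : L2 (Torus ν × Torus ν)) : flip (P.V₁ f) = P.V₂ (flip f) := by
  apply Lp.ext
  have hs : ∀ᵐ x : Torus ν × Torus ν, ∀ᵐ s : Torus ν, flip f (x.1, s) = f (s, x.1) :=
    (bp_fst (ν := ν)).qmp.ae (Measure.ae_ae_of_ae_prod (coeFn_flip f))
  filter_upwards [coeFn_flip (P.V₁ f), swap_ae (P.coeFn_V₁ f), P.coeFn_V₂ (flip f), hs]
    with x h1 h2 h3 h4
  rw [h1, h2, h3]
  refine integral_congr_ae ?_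
  filter_upwards [h4] with s h5
  simp only [Prod.fst_swap, Prod.snd_swap]
  rw [h5, P.v₂_symm]

theorem flip_V₂ (f : L2 (Torus ν × Torus ν)) : flip (P.V₂ f) = P.V₁ (flip f) := by
  rw [← flip_flip (P.V₁ (flip f)), flip_V₁, flip_flip]

theorem flip_H₂₂free (f : L2 (Torus ν × Torus ν)) : flip (P.H₂₂free f) = P.H₂₂free (flip f) := by
  apply Lp.ext
  filter_upwards [coeFn_flip (P.H₂₂free f), swap_ae (P.coeFn_H₂₂free f),
    P.coeFn_H₂₂free (flip f), coeFn_flip f] with x h1 h2 h3 h4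
  rw [h1, h2, h3, h4, show P.w₂ x.swap = P.w₂ x from P.w₂_symm x.2 x.1]

theorem flip_H₂₁left (f : L2 (Torus ν)) : flip (P.H₂₁left f) = P.H₂₁right f := by
  apply Lp.ext
  filter_upwards [coeFn_flip (P.H₂₁left f), swap_ae (P.coeFn_H₂₁left f), P.coeFn_H₂₁right f]
    with x h1 h2 h3
  rw [h1, h2, h3]
  rfl

/-! ### Self-adjointness -/

theorem inner_H₁₂ (g : L2 (Torus ν × Torus ν)) (f : L2 (Torus ν)) :
    inner ℂ (P.H₁₂ g) f = inner ℂ g (P.H₂₁left f) := by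
  rw [L2.inner_def, L2.inner_def]
  have hint := L2.integrable_inner (𝕜 := ℂ) g (P.H₂₁left f)
  refine Eq.trans ?_ (integral_prod _ hint).symm
  refine integral_congr_ae ?_
  filter_upwards [P.coeFn_H₁₂ g, Measure.ae_ae_of_ae_prod (P.coeFn_H₂₁left f)] with x h1 h2
  rw [h1, RCLike.inner_apply, ← integral_conj, ← integral_const_mul]
  refine integral_congr_ae ?_
  filter_upwards [h2] with s h3
  rw [h3, RCLike.inner_apply]
  simp
  ring

theorem isSelfAdjoint_v : IsSelfAdjoint P.v := by
  rw [ContinuousLinearMap.isSelfAdjoint_iff_isSymmetric]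
  intro f g
  change inner ℂ (P.v f) g = inner ℂ f (P.v g)
  let W : L2 (Torus ν) →L[ℂ] L2 (Torus ν × Torus ν) :=
    weightedComp (fun x => P.v₂ x) (by fun_prop) (fun x => x.2) bp_snd
  let J : L2 (Torus ν) →L[ℂ] L2 (Torus ν × Torus ν) :=
    weightedComp (fun _ => 1) (by fun_prop) (fun x => x.1) bp_fst
  have hW : ∀ f, W f =ᵐ[volume] fun x => (P.v₂ x : ℂ) * f x.2 :=
    fun f => coeFn_weightedComp _ _ _ _ f
  have hJ : ∀ f, J f =ᵐ[volume] fun x => f x.1 :=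
    fun f => (coeFn_weightedComp _ _ _ _ f).trans (Eventually.of_forall fun x => by simp)
  -- Lifting the form to the square by Fubini turns symmetry of `v` into a swap of the two
  -- variables.
  have key : ∀ f g, inner ℂ f (P.v g) = inner ℂ (J f) (W g) := by
    intro f g
    rw [L2.inner_def, L2.inner_def]
    refine Eq.trans ?_ (integral_prod _ (L2.integrable_inner (𝕜 := ℂ) (J f) (W g))).symm
    refine integral_congr_ae ?_
    filter_upwards [P.coeFn_v g, Measure.ae_ae_of_ae_prod (hW g),
      Measure.ae_ae_of_ae_prod (hJ f)] with x h1 h2 h3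
    rw [h1, RCLike.inner_apply, ← integral_mul_const]
    refine integral_congr_ae ?_
    filter_upwards [h2, h3] with s h4 h5
    rw [h4, h5, RCLike.inner_apply]
  rw [← inner_conj_symm, key, key, inner_conj_symm, L2.inner_def, L2.inner_def]
  have hsw := (Measure.measurePreserving_swap (μ := (volume : Measure (Torus ν)))
    (ν := (volume : Measure (Torus ν)))).integral_comp
    MeasurableEquiv.prodComm.measurableEmbedding (fun x => inner ℂ (W f x) (J g x))
  refine Eq.trans hsw.symm ?_
  refine integral_congr_ae ?_
  filter_upwards [hW g, hJ f, swap_ae (hW f), swap_ae (hJ g)] with x h1 h2 h3 h4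
  rw [h1, h2, h3, h4, show P.v₂ x.swap = P.v₂ x from P.v₂_symm x.2 x.1]
  simp
  ring

theorem isSelfAdjoint_fiber (p : Torus ν) : IsSelfAdjoint (P.fiber p) := by
  refine isSelfAdjoint_blockOp ?_ ((isSelfAdjoint_mulOp _ _).sub P.isSelfAdjoint_v) ?_
  · exact IsSelfAdjoint.smul (Complex.conj_ofReal _) (IsSelfAdjoint.one _)
  · intro x y
    simp only [smul_apply, inner_smul_left, inner_smul_right,
      inner_functional, Complex.conj_ofReal]

theorem isSelfAdjoint_channel (hV₂ : P.V₂.IsPositive) : IsSelfAdjoint P.channel := by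
  refine isSelfAdjoint_blockOp (isSelfAdjoint_mulOp _ _)
    ((isSelfAdjoint_mulOp _ _).sub hV₂.isSelfAdjoint) ?_
  intro x y
  simp only [smul_apply, inner_smul_left, inner_smul_right,
    inner_H₁₂, Complex.conj_ofReal]

theorem coe_H₂₁ (f : L2 (Torus ν)) :
    (P.H₂₁ f : L2 (Torus ν × Torus ν)) = (1 / 2 : ℂ) • (P.H₂₁right f + P.H₂₁left f) := rfl

theorem coe_H₂₂ (f : symmL2 ν) :
    (P.H₂₂ f : L2 (Torus ν × Torus ν)) = P.H₂₂free f - P.V₁ f - P.V₂ f := rfl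

theorem isSelfAdjoint_H (hV₁ : P.V₁.IsPositive) (hV₂ : P.V₂.IsPositive) :
    IsSelfAdjoint P.H := by
  refine isSelfAdjoint_blockOp ?_ (isSelfAdjoint_blockOp (isSelfAdjoint_mulOp _ _) ?_ ?_) ?_
  · exact IsSelfAdjoint.smul (Complex.conj_ofReal _) (IsSelfAdjoint.one _)
  · have hs : IsSelfAdjoint (P.H₂₂free - P.V₁ - P.V₂) :=
      ((isSelfAdjoint_mulOp _ _).sub hV₁.isSelfAdjoint).sub hV₂.isSelfAdjoint
    rw [ContinuousLinearMap.isSelfAdjoint_iff_isSymmetric] at hs ⊢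
    exact fun f g => hs f g
  · intro x y
    change inner ℂ (P.H₁₂ y) x = inner ℂ (y : L2 (Torus ν × Torus ν)) (P.H₂₁ x)
    have hr : inner ℂ (y : L2 (Torus ν × Torus ν)) (P.H₂₁right x)
        = inner ℂ (y : L2 (Torus ν × Torus ν)) (P.H₂₁left x) := by
      rw [← flip_H₂₁left, ← inner_flip, mem_symmL2_iff.1 y.2]
    rw [coe_H₂₁, inner_smul_right, inner_add_right, hr, inner_H₁₂]
    ring
  · intro x y
    rw [WithLp.prod_inner_apply]
    change inner ℂ (P.H₀₁ y.fst) x = inner ℂ y.fst (P.H₁₀ x) + inner ℂ y.snd (0 : symmL2 ν)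
    rw [inner_zero_right, add_zero]
    exact inner_functional _ _ _ _

/-! ### Products of operators in different variables -/

section Compact

variable {X : Type*} [MeasureSpace X] [IsFiniteMeasure (volume : Measure X)] [TopologicalSpace X]
  [CompactSpace X] [OpensMeasurableSpace X] {a : X × Torus ν → ℝ} (ha : Continuous a)
  {π : X → Torus ν}
  (hφ : BoundedPullback fun x : X × Torus ν => (π x.1, x.2))
  {r : Torus ν × Torus ν → ℝ} (hr : Continuous r)

/-- `V₁` integrates out the first variable and the outer operator the second, so the product is a
full integral operator with a continuous kernel, although neither factor need be compact. The space
`X` is left general to serve both `H₁₂` and `V₂`. -/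
theorem tendsto_partialIntegral_V₁ {u : ℕ → L2 (Torus ν × Torus ν)} (hu : WeaklyNull u)
    (hπ : Continuous π) :
    Tendsto (fun n => partialIntegral a ha _ hφ (mulOp r hr (P.V₁ (u n)))) atTop (𝓝 0) := by
  have hk : Continuous fun x : X × (Torus ν × Torus ν) =>
      a (x.1, x.2.2) * r (π x.1, x.2.2) * P.v₂ (π x.1, x.2.1) := by fun_prop
  refine hu.tendsto_integralOp hk (K := partialIntegral a ha _ hφ ∘L mulOp r hr ∘L P.V₁) ?_
  intro f
  have hae : ∀ᵐ y : Torus ν × Torus ν, mulOp r hr (P.V₁ f) y =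
      (r y : ℂ) * ∫ t : Torus ν, (P.v₂ (y.1, t) : ℂ) * f (t, y.2) := by
    filter_upwards [coeFn_mulOp r hr (P.V₁ f), P.coeFn_V₁ f] with y h1 h2
    rw [h1, h2]
  filter_upwards [coeFn_partialIntegral a ha _ hφ (mulOp r hr (P.V₁ f)),
    Measure.ae_ae_of_ae_prod (hφ.qmp.ae hae)] with x h1 h2
  refine h1.trans ?_
  have hkx : Continuous fun y : Torus ν × Torus ν =>
      a (x, y.2) * r (π x, y.2) * P.v₂ (π x, y.1) := by fun_prop
  have hint : Integrable (fun y : Torus ν × Torus ν =>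
      ((a (x, y.2) * r (π x, y.2) * P.v₂ (π x, y.1) : ℝ) : ℂ) * f y) :=
    (memLp_weighted bp_id hkx f).integrable (by norm_num)
  refine Eq.trans ?_ (integral_prod_symm _ hint).symm
  refine integral_congr_ae ?_
  filter_upwards [h2] with s h3
  rw [h3, ← mul_assoc, ← integral_const_mul]
  refine integral_congr_ae (Eventually.of_forall fun t => ?_)
  simp only
  push_cast
  ring

/-- `H₂₁right` places the argument in the second variable, exactly the one integrated afterwards;
again a continuous kernel results. -/
theorem tendsto_partialIntegral_H₂₁right {u : ℕ → L2 (Torus ν)} (hu : WeaklyNull u)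
    (hπ : Continuous π) :
    Tendsto (fun n => partialIntegral a ha _ hφ (mulOp r hr (P.H₂₁right (u n)))) atTop (𝓝 0) := by
  have hk : Continuous fun x : X × Torus ν =>
      a x * r (π x.1, x.2) * P.v₁ (π x.1) := by fun_prop
  refine hu.tendsto_integralOp hk (K := partialIntegral a ha _ hφ ∘L mulOp r hr ∘L P.H₂₁right) ?_
  intro f
  have hae : ∀ᵐ y : Torus ν × Torus ν, mulOp r hr (P.H₂₁right f) y =
      (r y : ℂ) * ((P.v₁ y.1 : ℂ) * f y.2) := by
    filter_upwards [coeFn_mulOp r hr (P.H₂₁right f), P.coeFn_H₂₁right f] with y h1 h2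
    rw [h1, h2]
  filter_upwards [coeFn_partialIntegral a ha _ hφ (mulOp r hr (P.H₂₁right f)),
    Measure.ae_ae_of_ae_prod (hφ.qmp.ae hae)] with x h1 h2
  refine h1.trans (integral_congr_ae ?_)
  filter_upwards [h2] with s h3
  rw [h3]
  push_cast
  ring

end Compact

theorem tendsto_v {u : ℕ → L2 (Torus ν)} (hu : WeaklyNull u) :
    Tendsto (fun n => P.v (u n)) atTop (𝓝 0) :=
  hu.tendsto_integralOp P.v₂.continuous P.coeFn_v

end Parameters

/-! ### Weakly null sequences in Hilbert sums -/

section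

variable {E F : Type*} [NormedAddCommGroup E] [InnerProductSpace ℂ E]
  [NormedAddCommGroup F] [InnerProductSpace ℂ F]

theorem WeaklyNull.toLp {u : ℕ → E} {w : ℕ → F} (hu : WeaklyNull u) (hw : WeaklyNull w) :
    WeaklyNull (fun n => WithLp.toLp 2 (u n, w n)) := by
  obtain ⟨⟨C, hC⟩, hu⟩ := hu
  obtain ⟨⟨D, hD⟩, hw⟩ := hw
  refine ⟨⟨C + D, fun n => (norm_le_norm_fst_add_norm_snd _).trans (add_le_add (hC n) (hD n))⟩,
    fun y => ?_⟩
  simpa [WithLp.prod_inner_apply] using (hu y.fst).add (hw y.snd)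

theorem weaklyNull_zero : WeaklyNull (fun _ => (0 : E)) := ⟨⟨0, by simp⟩, by simp⟩

end

/-! ### Sequences concentrating at a point -/

/-- A sequence of unit vectors, weakly null, with supports shrinking to the point `p₀`. -/
structure ConcentratesAt (χ : ℕ → L2 (Torus ν)) (p₀ : Torus ν) : Prop where
  weaklyNull : WeaklyNull χ
  norm_eq_one : ∀ n, ‖χ n‖ = 1
  support : ∀ U ∈ 𝓝 p₀, ∀ᶠ n in atTop, ∀ᵐ x, χ n x ≠ 0 → x ∈ U

theorem ae_ne_point (hν : 1 ≤ ν) (p₀ : Torus ν) : ∀ᵐ x : Torus ν, x ≠ p₀ := by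
  -- A point of the circle is a closed ball of radius 0, hence null; `1 ≤ ν` provides a coordinate
  -- in which to use this.
  have : NullSingletonClass (volume : Measure (AddCircle (2 * Real.pi))) :=
    ⟨fun x => by simpa [Real.pi_pos.le] using AddCircle.volume_closedBall (2 * Real.pi) (x := x) 0⟩
  have h := Measure.ae_eval_ne (μ := fun _ : Fin ν => (volume : Measure (AddCircle (2 * Real.pi))))
    ⟨0, hν⟩ (p₀ ⟨0, hν⟩)
  change ∀ᵐ x : Torus ν, _ at h
  filter_upwards [h] with x hx hxp
  exact hx (congrFun hxp _)

theorem exists_concentratesAt (hν : 1 ≤ ν) (p₀ : Torus ν) :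
    ∃ χ : ℕ → L2 (Torus ν), ConcentratesAt χ p₀ := by
  let B : ℕ → Set (Torus ν) := fun n => Metric.ball p₀ (1 / ((n : ℝ) + 1))
  have hBm : ∀ n, MeasurableSet (B n) := fun n => measurableSet_ball
  have hBpos : ∀ n, 0 < volume.real (B n) := fun n =>
    ENNReal.toReal_pos (Metric.measure_ball_pos volume p₀ (by positivity)).ne' (measure_ne_top _ _)
  have hBsupp : ∀ U ∈ 𝓝 p₀, ∀ᶠ n in atTop, B n ⊆ U := fun U hU => by
    obtain ⟨ε, hε, hεU⟩ := Metric.mem_nhds_iff.1 hU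
    filter_upwards [tendsto_one_div_add_atTop_nhds_zero_nat.eventually_lt_const hε] with n hn
    exact (Metric.ball_subset_ball hn.le).trans hεU
  let χ : ℕ → L2 (Torus ν) := fun n => indicatorConstLp 2 (hBm n) (measure_ne_top _ _)
    ((((volume.real (B n)) ^ (1 / 2 : ℝ))⁻¹ : ℝ) : ℂ)
  have hχ0 : ∀ n, ∀ᵐ x, x ∉ B n → χ n x = 0 := fun n => by
    filter_upwards [indicatorConstLp_coeFn (p := 2) (hs := hBm n) (hμs := measure_ne_top volume _)
      (c := ((((volume.real (B n)) ^ (1 / 2 : ℝ))⁻¹ : ℝ) : ℂ))] with x hx hxB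
    exact hx.trans (Set.indicator_of_notMem hxB _)
  have hnorm : ∀ n, ‖χ n‖ = 1 := fun n => by
    have := hBpos n
    rw [norm_indicatorConstLp (by simp) (by simp)]
    have h2 : volume.real (B n) ^ (1 / 2 : ℝ) ≠ 0 := by positivity
    rw [Complex.norm_real, Real.norm_of_nonneg (by positivity), ENNReal.toReal_ofNat]
    exact inv_mul_cancel₀ h2
  refine ⟨χ, ⟨⟨⟨1, fun n => (hnorm n).le⟩, fun y => ?_⟩, hnorm, fun U hU => ?_⟩⟩
  -- Only the restriction of `y` to the ball meets `χ n`, and its norm tends to zero by dominated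
  -- convergence because the balls shrink to a null point.
  · let y' : ℕ → L2 (Torus ν) := fun n => ((Lp.memLp y).indicator (hBm n)).toLp _
    have hy' : ∀ n, y' n =ᵐ[volume] (B n).indicator y := fun n => MemLp.coeFn_toLp _
    have h1 : ∀ n, inner ℂ y (χ n) = inner ℂ (y' n) (χ n) := fun n => by
      rw [L2.inner_def, L2.inner_def]
      refine integral_congr_ae ?_
      filter_upwards [hy' n, hχ0 n] with x h2 h3
      rw [h2]
      by_cases hx : x ∈ B n
      · rw [Set.indicator_of_mem hx]
      · rw [h3 hx, inner_zero_right, inner_zero_right]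
    have h2 : Tendsto (fun n => ‖y' n‖ ^ 2) atTop (𝓝 0) := by
      have e : ∀ n, ‖y' n‖ ^ 2 = ∫ x, (B n).indicator (fun x => ‖y x‖ ^ 2) x := fun n => by
        rw [norm_sq_eq_integral]
        refine integral_congr_ae ?_
        filter_upwards [hy' n] with x hx
        rw [hx]
        by_cases hxB : x ∈ B n <;> simp [hxB]
      have h0 : (0 : ℝ) = ∫ x : Torus ν, (0 : ℝ) := by simp
      simp only [e]
      rw [h0]
      refine tendsto_integral_of_dominated_convergence (fun x => ‖y x‖ ^ 2) (fun n => ?_)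
        (integrable_norm_sq y) (fun n => ?_) ?_
      · exact (integrable_norm_sq y).aestronglyMeasurable.indicator (hBm n)
      · refine Eventually.of_forall fun x => (norm_indicator_le_norm_self _ _).trans ?_
        simp
      · filter_upwards [ae_ne_point hν p₀] with x hx
        refine tendsto_const_nhds.congr' ?_
        filter_upwards [hBsupp _ (isOpen_ne.mem_nhds hx.symm)] with n hn
        rw [Set.indicator_of_notMem (fun hxB => hn hxB rfl)]
    refine squeeze_zero_norm (a := fun n => ‖y' n‖) (fun n => ?_) ?_
    · rw [h1]
      simpa [hnorm n] using norm_inner_le_norm (𝕜 := ℂ) (y' n) (χ n)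
    · simpa [Real.sqrt_sq (norm_nonneg _)] using h2.sqrt
  · filter_upwards [hBsupp U hU] with n hn
    filter_upwards [hχ0 n] with x hx hx0
    exact hn (by_contra fun h => hx0 (hx h))

/-! ### Products of functions of one variable -/

theorem memLp_mul_prod (χ φ : L2 (Torus ν)) :
    MemLp (fun x : Torus ν × Torus ν => χ x.1 * φ x.2) 2 := by
  have hm : AEStronglyMeasurable (fun x : Torus ν × Torus ν => χ x.1 * φ x.2) volume :=
    ((Lp.aestronglyMeasurable χ).comp_quasiMeasurePreserving bp_fst.qmp).mul
      ((Lp.aestronglyMeasurable φ).comp_quasiMeasurePreserving bp_snd.qmp)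
  rw [memLp_two_iff_integrable_sq_norm hm]
  simp only [norm_mul, mul_pow]
  exact (integrable_norm_sq χ).mul_prod (integrable_norm_sq φ)

theorem norm_toLp_mul_prod (χ φ : L2 (Torus ν)) :
    ‖(memLp_mul_prod χ φ).toLp‖ = ‖χ‖ * ‖φ‖ := by
  rw [← sq_eq_sq₀ (by positivity) (by positivity), mul_pow, norm_sq_eq_integral,
    norm_sq_eq_integral, norm_sq_eq_integral, ← integral_prod_mul]
  refine integral_congr_ae ?_
  filter_upwards [(memLp_mul_prod χ φ).coeFn_toLp] with x hx
  rw [hx, norm_mul, mul_pow]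

/-- The product `(p, q) ↦ χ(p) φ(q)`. -/
def tensor : L2 (Torus ν) →L[ℂ] L2 (Torus ν) →L[ℂ] L2 (Torus ν × Torus ν) :=
  LinearMap.mkContinuous₂
    (LinearMap.mk₂ ℂ (fun χ φ => (memLp_mul_prod χ φ).toLp)
      (fun χ χ' φ => by
        rw [← MemLp.toLp_add, MemLp.toLp_eq_toLp_iff]
        filter_upwards [bp_fst.qmp.ae (Lp.coeFn_add χ χ')] with x hx
        rw [hx, Pi.add_apply, Pi.add_apply, add_mul])
      (fun c χ φ => by
        rw [← MemLp.toLp_const_smul, MemLp.toLp_eq_toLp_iff]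
        filter_upwards [bp_fst.qmp.ae (Lp.coeFn_smul c χ)] with x hx
        rw [hx, Pi.smul_apply, Pi.smul_apply, smul_mul_assoc])
      (fun χ φ φ' => by
        rw [← MemLp.toLp_add, MemLp.toLp_eq_toLp_iff]
        filter_upwards [bp_snd.qmp.ae (Lp.coeFn_add φ φ')] with x hx
        rw [hx, Pi.add_apply, Pi.add_apply, mul_add])
      (fun c χ φ => by
        rw [← MemLp.toLp_const_smul, MemLp.toLp_eq_toLp_iff]
        filter_upwards [bp_snd.qmp.ae (Lp.coeFn_smul c φ)] with x hx
        rw [hx, Pi.smul_apply, Pi.smul_apply, mul_smul_comm]))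
    1 (fun χ φ => by
      rw [one_mul]
      exact (norm_toLp_mul_prod χ φ).le)

theorem coeFn_tensor (χ φ : L2 (Torus ν)) : tensor χ φ =ᵐ[volume] fun x => χ x.1 * φ x.2 :=
  (memLp_mul_prod χ φ).coeFn_toLp

theorem norm_tensor (χ φ : L2 (Torus ν)) : ‖tensor χ φ‖ = ‖χ‖ * ‖φ‖ := norm_toLp_mul_prod χ φ

theorem flip_tensor (χ φ : L2 (Torus ν)) : flip (tensor χ φ) = tensor φ χ := by
  apply Lp.ext
  filter_upwards [coeFn_flip (tensor χ φ), Parameters.swap_ae (coeFn_tensor χ φ),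
    coeFn_tensor φ χ] with x h1 h2 h3
  rw [h1, h2, h3, mul_comm]
  rfl

theorem inner_tensor (χ φ χ' φ' : L2 (Torus ν)) :
    inner ℂ (tensor χ φ) (tensor χ' φ') = inner ℂ χ χ' * inner ℂ φ φ' := by
  rw [L2.inner_def, L2.inner_def, L2.inner_def, ← integral_prod_mul]
  refine integral_congr_ae ?_
  filter_upwards [coeFn_tensor χ φ, coeFn_tensor χ' φ'] with x h1 h2
  rw [h1, h2]
  simp
  ring

theorem mulOp_snd_tensor (k : Torus ν → ℝ) (hk : Continuous k) (χ φ : L2 (Torus ν)) :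
    mulOp (fun x : Torus ν × Torus ν => k x.2) (hk.comp continuous_snd) (tensor χ φ)
      = tensor χ (mulOp k hk φ) := by
  apply Lp.ext
  filter_upwards [coeFn_mulOp (fun x : Torus ν × Torus ν => k x.2) (hk.comp continuous_snd)
    (tensor χ φ), coeFn_tensor χ φ, coeFn_tensor χ (mulOp k hk φ),
    bp_snd.qmp.ae (coeFn_mulOp k hk φ)] with x h1 h2 h3 h4
  rw [h1, h2, h3, h4]
  ring

namespace Parameters

variable (P : Parameters ν)

theorem V₂_tensor (χ φ : L2 (Torus ν)) : P.V₂ (tensor χ φ) = tensor χ (P.v φ) := by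
  apply Lp.ext
  filter_upwards [P.coeFn_V₂ (tensor χ φ), coeFn_tensor χ (P.v φ), bp_snd.qmp.ae (P.coeFn_v φ),
    bp_fst.qmp.ae (Measure.ae_ae_of_ae_prod (coeFn_tensor χ φ))] with x h1 h2 h3 h4
  rw [h1, h2, h3, ← integral_const_mul]
  refine integral_congr_ae ?_
  filter_upwards [h4] with s h5
  rw [h5, P.v₂_symm]
  ring

theorem V₁_tensor (χ φ : L2 (Torus ν)) : P.V₁ (tensor χ φ) = tensor (P.v χ) φ := by
  rw [← flip_tensor φ χ, ← flip_V₂, V₂_tensor, flip_tensor]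

theorem H₁₂_tensor (χ φ : L2 (Torus ν)) :
    P.H₁₂ (tensor χ φ) = functional (fun s => P.v₁ s) (by fun_prop) φ • χ := by
  apply Lp.ext
  filter_upwards [P.coeFn_H₁₂ (tensor χ φ), Measure.ae_ae_of_ae_prod (coeFn_tensor χ φ),
    Lp.coeFn_smul (functional (fun s => P.v₁ s) (by fun_prop) φ) χ] with x h1 h2 h3
  rw [h1, h3, Pi.smul_apply, functional_apply, smul_eq_mul, ← integral_mul_const]
  refine integral_congr_ae ?_
  filter_upwards [h2] with s h4
  rw [h4]
  ring

theorem H₂₁left_eq_tensor (χ : L2 (Torus ν)) :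
    P.H₂₁left χ = tensor χ (creation (fun q => P.v₁ q) (by fun_prop) 1) := by
  apply Lp.ext
  have hc : (creation (fun q => P.v₁ q) (by fun_prop) 1 : L2 (Torus ν)) =ᵐ[volume]
      fun q => (P.v₁ q : ℂ) := by
    rw [creation_apply, one_smul]
    exact MemLp.coeFn_toLp _
  filter_upwards [P.coeFn_H₂₁left χ, coeFn_tensor χ _, bp_snd.qmp.ae hc] with x h1 h2 h3
  rw [h1, h2, h3, mul_comm]

end Parameters

/-! ### Concentrating sequences and the vectors they localize -/

theorem ConcentratesAt.tendsto_mulOp {χ : ℕ → L2 (Torus ν)} {q₀ : Torus ν}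
    (hχ : ConcentratesAt χ q₀) {k : Torus ν → ℝ} (hk : Continuous k) (h0 : k q₀ = 0) :
    Tendsto (fun n => mulOp k hk (χ n)) atTop (𝓝 0) := by
  rw [Metric.tendsto_nhds]
  intro ε hε
  have hU : {q | |k q| ≤ ε / 2} ∈ 𝓝 q₀ := by
    filter_upwards [Metric.continuousAt_iff'.1 (hk.continuousAt (x := q₀)) _ (half_pos hε)]
      with q hq
    rw [h0, dist_zero_right, Real.norm_eq_abs] at hq
    exact hq.le
  filter_upwards [hχ.support _ hU] with n hn
  rw [dist_zero_right]
  have := norm_mulOp_le k hk hn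
  rw [hχ.norm_eq_one] at this
  linarith

theorem ae_memLp_section (F : L2 (Torus ν × Torus ν)) :
    ∀ᵐ p : Torus ν, MemLp (fun q => F (p, q)) 2 := by
  filter_upwards [(Lp.aestronglyMeasurable F).prodMk_left,
    (integrable_norm_sq F).prod_right_ae] with p h1 h2
  exact (memLp_two_iff_integrable_sq_norm h1).2 h2

/-- The vector `(f₀ χ, χ ⊗ f₁)` of the channel space. -/
def localize (χ : L2 (Torus ν)) (f : FiberSpace ν) : ChannelSpace ν :=
  WithLp.toLp 2 (f.fst • χ, tensor χ f.snd)

theorem localize_fst (χ : L2 (Torus ν)) (f : FiberSpace ν) : (localize χ f).fst = f.fst • χ := rfl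

theorem localize_snd (χ : L2 (Torus ν)) (f : FiberSpace ν) :
    (localize χ f).snd = tensor χ f.snd := rfl

theorem norm_localize (χ : L2 (Torus ν)) (hχ : ‖χ‖ = 1) (f : FiberSpace ν) :
    ‖localize χ f‖ = ‖f‖ := by
  rw [← sq_eq_sq₀ (norm_nonneg _) (norm_nonneg _), localize, norm_toLp_sq,
    WithLp.prod_norm_sq_eq_of_L2, norm_smul, norm_tensor, hχ, one_mul, mul_one]

namespace Parameters

variable (P : Parameters ν)

/-! ### The fiber operators -/

theorem fiber_fst (p : Torus ν) (f : FiberSpace ν) :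
    (P.fiber p f).fst = (P.w₁ p : ℂ) • f.fst +
      ((1 / √2 : ℝ) : ℂ) • functional (fun s => P.v₁ s) (by fun_prop) f.snd := rfl

theorem fiber_snd (p : Torus ν) (f : FiberSpace ν) :
    (P.fiber p f).snd = ((1 / √2 : ℝ) : ℂ) • creation (fun q => P.v₁ q) (by fun_prop) f.fst +
      (mulOp (fun q => P.w₂ (p, q)) (by fun_prop) f.snd - P.v f.snd) := rfl

theorem eventually_abs_w₂_sub_le (p₀ : Torus ν) {ε : ℝ} (hε : 0 < ε) :
    ∀ᶠ p in 𝓝 p₀, ∀ q, |P.w₂ (p, q) - P.w₂ (p₀, q)| ≤ ε := by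
  have h := P.w₂.curry.continuous.continuousAt (x := p₀)
  filter_upwards [Metric.continuousAt_iff'.1 h ε hε] with p hp q
  exact ((ContinuousMap.dist_lt_iff hε).1 hp q).le

theorem eventually_abs_w₁_sub_le (p₀ : Torus ν) {ε : ℝ} (hε : 0 < ε) :
    ∀ᶠ p in 𝓝 p₀, |P.w₁ p - P.w₁ p₀| ≤ ε := by
  filter_upwards [Metric.continuousAt_iff'.1 (P.w₁.continuous.continuousAt (x := p₀)) ε hε]
    with p hp
  exact hp.le

theorem eventually_norm_fiber_sub_le (p₀ : Torus ν) {ε : ℝ} (hε : 0 < ε) :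
    ∀ᶠ p in 𝓝 p₀, ∀ f, ‖P.fiber p f - P.fiber p₀ f‖ ≤ ε * ‖f‖ := by
  filter_upwards [P.eventually_abs_w₁_sub_le p₀ (half_pos hε),
    P.eventually_abs_w₂_sub_le p₀ (half_pos hε)] with p h1 h2 f
  refine (norm_le_norm_fst_add_norm_snd _).trans ?_
  have e1 : (P.fiber p f - P.fiber p₀ f).fst = ((P.w₁ p - P.w₁ p₀ : ℝ) : ℂ) • f.fst := by
    rw [WithLp.sub_fst, fiber_fst, fiber_fst]
    push_cast
    module
  have e2 : (P.fiber p f - P.fiber p₀ f).snd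
      = mulOp (fun q => P.w₂ (p, q) - P.w₂ (p₀, q)) (by fun_prop) f.snd := by
    rw [WithLp.sub_snd, fiber_snd, fiber_snd, mulOp_sub _ _ (by fun_prop) (by fun_prop)]
    abel
  have n1 : ‖(P.fiber p f - P.fiber p₀ f).fst‖ ≤ ε / 2 * ‖f‖ := by
    rw [e1, norm_smul, Complex.norm_real, Real.norm_eq_abs]
    gcongr
    exact norm_fst_le_norm f
  have n2 : ‖(P.fiber p f - P.fiber p₀ f).snd‖ ≤ ε / 2 * ‖f‖ := by
    rw [e2]
    refine (norm_mulOp_le _ _ (C := ε / 2) (Eventually.of_forall fun q _ => h2 q)).trans ?_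
    gcongr
    exact norm_snd_le_norm f
  linarith

/-- A lower bound `c` at `p₀` survives as `c / 2` nearby, since the fibers vary continuously in
norm; compactness of the torus leaves finitely many constants. -/
theorem exists_uniform_bddBelow_fiber {z : ℂ} (hz : ∀ p, z ∉ spectrum ℂ (P.fiber p)) :
    ∃ c > 0, ∀ p f, c * ‖f‖ ≤ ‖P.fiber p f - z • f‖ := by
  have key : ∃ c > 0, ∀ p ∈ (Set.univ : Set (Torus ν)), ∀ f,
      c * ‖f‖ ≤ ‖P.fiber p f - z • f‖ := by
    refine isCompact_univ.induction_on
      (p := fun s => ∃ c > 0, ∀ p ∈ s, ∀ f, c * ‖f‖ ≤ ‖P.fiber p f - z • f‖) ?_ ?_ ?_ ?_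
    · exact ⟨1, one_pos, fun p hp => hp.elim⟩
    · rintro s t hst ⟨c, hc, h⟩
      exact ⟨c, hc, fun p hp => h p (hst hp)⟩
    · rintro s t ⟨c, hc, h⟩ ⟨d, hd, h'⟩
      refine ⟨min c d, lt_min hc hd, fun p hp f => ?_⟩
      rcases hp with hp | hp
      · exact le_trans (by gcongr; exact min_le_left _ _) (h p hp f)
      · exact le_trans (by gcongr; exact min_le_right _ _) (h' p hp f)
    · intro p₀ _
      obtain ⟨c, hc, h⟩ := bddBelow_of_notMem_spectrum (hz p₀)
      rw [nhdsWithin_univ]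
      refine ⟨_, P.eventually_norm_fiber_sub_le p₀ (half_pos hc), c / 2, half_pos hc,
        fun p hp f => ?_⟩
      have h1 : P.fiber p₀ f - z • f
          = (P.fiber p f - z • f) - (P.fiber p f - P.fiber p₀ f) := by abel
      have h2 := h f
      rw [h1] at h2
      linarith [norm_sub_le (P.fiber p f - z • f) (P.fiber p f - P.fiber p₀ f), hp f]
  obtain ⟨c, hc, h⟩ := key
  exact ⟨c, hc, fun p f => h p trivial f⟩

/-- The vectors `(0, χₙ)` with `χₙ` concentrating at `q` are approximate eigenvectors: the
functional and `v` vanish along them by weak nullity, and multiplication by `w₂(p, ·)` freezes at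
`q`. -/
theorem mem_spectrum_fiber (hν : 1 ≤ ν) (p q : Torus ν) :
    ((P.w₂ (p, q) : ℝ) : ℂ) ∈ spectrum ℂ (P.fiber p) := by
  obtain ⟨χ, hχ⟩ := exists_concentratesAt hν q
  refine mem_spectrum_of_approx fun ε hε => ⟨fun n => WithLp.toLp 2 (0, χ n), fun n => ?_, ?_⟩
  · exact (hχ.norm_eq_one n).symm.le.trans (norm_snd_le_norm (WithLp.toLp 2 ((0 : ℂ), χ n)))
  have h1 : Tendsto (fun n => ((1 / √2 : ℝ) : ℂ) •
      functional (fun s => P.v₁ s) (by fun_prop) (χ n)) atTop (𝓝 0) := by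
    simpa using (hχ.weaklyNull.tendsto_functional (k := fun s => P.v₁ s) (by fun_prop)).const_smul
      ((1 / √2 : ℝ) : ℂ)
  have h2 : Tendsto (fun n => mulOp (fun s => P.w₂ (p, s) - P.w₂ (p, q)) (by fun_prop) (χ n)
      - P.v (χ n)) atTop (𝓝 0) := by
    simpa using (hχ.tendsto_mulOp (k := fun s => P.w₂ (p, s) - P.w₂ (p, q)) (by fun_prop)
      (sub_self _)).sub (P.tendsto_v hχ.weaklyNull)
  have h3 := h1.norm.add h2.norm
  simp only [norm_zero, add_zero] at h3
  filter_upwards [h3.eventually_lt_const hε] with n hn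
  refine (norm_le_norm_fst_add_norm_snd _).trans (le_trans (le_of_eq ?_) hn.le)
  congr 2
  · rw [WithLp.sub_fst, fiber_fst, WithLp.smul_fst]
    change _ • (0 : ℂ) + _ - _ • (0 : ℂ) = _
    rw [smul_zero, smul_zero, zero_add, sub_zero]
    rfl
  · rw [WithLp.sub_snd, fiber_snd, mulOp_sub _ _ (by fun_prop) (by fun_prop), mulOp_const,
      WithLp.smul_snd]
    change _ • creation _ _ (0 : ℂ) + (mulOp _ _ (χ n) - P.v (χ n)) - _ • χ n = _
    rw [map_zero, smul_zero]
    abel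

/-- Apart from multiplication by `w₂(p, ·)`, everything in the fiber tends to zero along a Weyl
sequence. Were `w₂(p, ·) - z` nowhere zero, it could be inverted and the sequence itself would tend
to zero. -/
theorem mem_range_of_mem_essentialSpectrum_fiber {p : Torus ν} {z : ℂ}
    (hz : z ∈ essentialSpectrum (P.fiber p)) : ∃ q, z = P.w₂ (p, q) := by
  have hre := eq_re_of_mem_essentialSpectrum (P.isSelfAdjoint_fiber p) hz
  obtain ⟨u, hu, hu1, hlim⟩ :=
    exists_weaklyNull_of_mem_essentialSpectrum (P.isSelfAdjoint_fiber p) hz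
  by_contra! hcon
  have hne : ∀ q, P.w₂ (p, q) - z.re ≠ 0 := fun q h =>
    hcon q (by rw [hre, sub_eq_zero.1 h])
  have hk : Continuous fun q => P.w₂ (p, q) - z.re := by fun_prop
  have hfst : Tendsto (fun n => (u n).fst) atTop (𝓝 0) :=
    (hu.map (WithLp.fstL 2 ℂ ℂ (L2 (Torus ν)))).tendsto_zero
  have hv := P.tendsto_v (hu.map (WithLp.sndL 2 ℂ ℂ (L2 (Torus ν))))
  have hs := ((WithLp.sndL 2 ℂ ℂ (L2 (Torus ν))).continuous.tendsto 0).comp hlim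
  rw [map_zero] at hs
  have hc := ((((1 / √2 : ℝ) : ℂ) • creation (fun q => P.v₁ q)
    (P.v₁.continuous)).continuous.tendsto 0).comp hfst
  rw [map_zero] at hc
  have hm : Tendsto (fun n => mulOp _ hk (u n).snd) atTop (𝓝 0) := by
    have := (hs.sub hc).add hv
    simp only [sub_zero, add_zero] at this
    refine this.congr fun n => ?_
    change (P.fiber p (u n) - z • u n).snd - ((1 / √2 : ℝ) : ℂ) •
      creation (fun q => P.v₁ q) _ (u n).fst + P.v (u n).snd = _
    rw [WithLp.sub_snd, fiber_snd, mulOp_sub _ _ (by fun_prop) (by fun_prop), mulOp_const, ← hre,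
      WithLp.smul_snd]
    abel
  have hsnd : Tendsto (fun n => (u n).snd) atTop (𝓝 0) := by
    have := ((mulOp _ (hk.inv₀ hne)).continuous.tendsto 0).comp hm
    rw [map_zero] at this
    refine this.congr fun n => ?_
    exact mulOp_inv_mulOp hk hne _
  have h1 := hfst.norm.add hsnd.norm
  simp only [norm_zero, add_zero] at h1
  obtain ⟨n, hn⟩ := (h1.eventually_lt_const one_pos).exists
  linarith [hu1 n, norm_le_norm_fst_add_norm_snd (u n)]

/-! ### The channel operator -/

theorem channel_fst (g : ChannelSpace ν) :
    (P.channel g).fst = P.H₁₁ g.fst + ((1 / √2 : ℝ) : ℂ) • P.H₁₂ g.snd := rfl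

theorem channel_snd (g : ChannelSpace ν) :
    (P.channel g).snd =
      ((1 / √2 : ℝ) : ℂ) • P.H₂₁left g.fst + (P.H₂₂free g.snd - P.V₂ g.snd) := rfl

theorem coeFn_channel_sub_fst (z : ℂ) (g : ChannelSpace ν) :
    (P.channel g - z • g).fst =ᵐ[volume] fun p => (P.w₁ p : ℂ) * g.fst p +
      ((1 / √2 : ℝ) : ℂ) * (∫ s : Torus ν, (P.v₁ s : ℂ) * g.snd (p, s)) - z * g.fst p := by
  rw [WithLp.sub_fst, WithLp.smul_fst, channel_fst]
  filter_upwards [Lp.coeFn_sub (P.H₁₁ g.fst + ((1 / √2 : ℝ) : ℂ) • P.H₁₂ g.snd) (z • g.fst),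
    Lp.coeFn_add (P.H₁₁ g.fst) (((1 / √2 : ℝ) : ℂ) • P.H₁₂ g.snd),
    Lp.coeFn_smul ((1 / √2 : ℝ) : ℂ) (P.H₁₂ g.snd), Lp.coeFn_smul z g.fst,
    P.coeFn_H₁₁ g.fst, P.coeFn_H₁₂ g.snd] with p h1 h2 h3 h4 h5 h6
  rw [h1, Pi.sub_apply, h2, Pi.add_apply, h3, h4, Pi.smul_apply, Pi.smul_apply, h5, h6,
    smul_eq_mul, smul_eq_mul]

theorem coeFn_channel_sub_snd (z : ℂ) (g : ChannelSpace ν) :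
    (P.channel g - z • g).snd =ᵐ[volume] fun x =>
      ((1 / √2 : ℝ) : ℂ) * ((P.v₁ x.2 : ℂ) * g.fst x.1) + ((P.w₂ x : ℂ) * g.snd x -
        ∫ s : Torus ν, (P.v₂ (s, x.2) : ℂ) * g.snd (x.1, s)) - z * g.snd x := by
  rw [WithLp.sub_snd, WithLp.smul_snd, channel_snd]
  filter_upwards [Lp.coeFn_sub (((1 / √2 : ℝ) : ℂ) • P.H₂₁left g.fst +
      (P.H₂₂free g.snd - P.V₂ g.snd)) (z • g.snd),
    Lp.coeFn_add (((1 / √2 : ℝ) : ℂ) • P.H₂₁left g.fst) (P.H₂₂free g.snd - P.V₂ g.snd),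
    Lp.coeFn_sub (P.H₂₂free g.snd) (P.V₂ g.snd),
    Lp.coeFn_smul ((1 / √2 : ℝ) : ℂ) (P.H₂₁left g.fst), Lp.coeFn_smul z g.snd,
    P.coeFn_H₂₁left g.fst, P.coeFn_H₂₂free g.snd, P.coeFn_V₂ g.snd]
    with p h1 h2 h3 h4 h5 h6 h7 h8
  rw [h1, Pi.sub_apply, h2, Pi.add_apply, h3, Pi.sub_apply, h4, h5, Pi.smul_apply, Pi.smul_apply,
    h6, h7, h8, smul_eq_mul, smul_eq_mul]

/-- The variable `p` is a mere parameter of the channel operator, which is the direct integral of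
the fibers: the squared fiber bound holds on almost every section and is integrated over `p`. -/
theorem bddBelow_channel {z : ℂ} {c : ℝ} (hc : 0 < c)
    (h : ∀ p f, c * ‖f‖ ≤ ‖P.fiber p f - z • f‖) (g : ChannelSpace ν) :
    c * ‖g‖ ≤ ‖P.channel g - z • g‖ := by
  set G := P.channel g - z • g with hG
  have hsec : ∀ᵐ p : Torus ν, c ^ 2 * (‖g.fst p‖ ^ 2 + ∫ q, ‖g.snd (p, q)‖ ^ 2) ≤
      ‖G.fst p‖ ^ 2 + ∫ q, ‖G.snd (p, q)‖ ^ 2 := by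
    filter_upwards [ae_memLp_section g.snd, P.coeFn_channel_sub_fst z g,
      Measure.ae_ae_of_ae_prod (P.coeFn_channel_sub_snd z g)] with p hmem h1 h2
    set φ : L2 (Torus ν) := hmem.toLp _ with hφ
    have hφc : φ =ᵐ[volume] fun q => g.snd (p, q) := hmem.coeFn_toLp
    set f : FiberSpace ν := WithLp.toLp 2 (g.fst p, φ) with hf
    have e0 : ‖f‖ ^ 2 = ‖g.fst p‖ ^ 2 + ∫ q, ‖g.snd (p, q)‖ ^ 2 := by
      rw [hf, norm_toLp_sq, norm_sq_eq_integral φ]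
      congr 1
      refine integral_congr_ae ?_
      filter_upwards [hφc] with q hq
      rw [hq]
    have e1 : (P.fiber p f - z • f).fst = G.fst p := by
      rw [hG, h1, WithLp.sub_fst, fiber_fst, functional_apply]
      simp only [WithLp.smul_fst, smul_eq_mul]
      congr 3
      refine integral_congr_ae ?_
      filter_upwards [hφc] with q hq
      rw [← hq]
      rfl
    have e2 : (P.fiber p f - z • f).snd =ᵐ[volume] fun q => G.snd (p, q) := by
      rw [WithLp.sub_snd, fiber_snd, WithLp.smul_snd, creation_apply]
      change (_ • (g.fst p • _) + (mulOp _ _ φ - P.v φ) - z • φ : L2 (Torus ν)) =ᵐ[volume] _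
      have hk : Continuous fun q => P.v₁ q := by fun_prop
      have hw : Continuous fun q => P.w₂ (p, q) := by fun_prop
      filter_upwards [h2, hφc, P.coeFn_v φ, coeFn_mulOp _ hw φ,
        (memLp_continuous hk).coeFn_toLp,
        Lp.coeFn_sub (((1 / √2 : ℝ) : ℂ) • (g.fst p • (memLp_continuous hk).toLp _) +
          (mulOp _ hw φ - P.v φ)) (z • φ),
        Lp.coeFn_add (((1 / √2 : ℝ) : ℂ) • (g.fst p • (memLp_continuous hk).toLp _))
          (mulOp _ hw φ - P.v φ),
        Lp.coeFn_sub (mulOp _ hw φ) (P.v φ), Lp.coeFn_smul z φ,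
        Lp.coeFn_smul ((1 / √2 : ℝ) : ℂ) (g.fst p • (memLp_continuous hk).toLp _),
        Lp.coeFn_smul (g.fst p) ((memLp_continuous hk).toLp _)]
        with q a1 a2 a3 a4 a5 a6 a7 a8 a9 a10 a11
      rw [hG, a1, a6, Pi.sub_apply, a7, Pi.add_apply, a8, Pi.sub_apply, a9, a10, Pi.smul_apply,
        Pi.smul_apply, a11, Pi.smul_apply, a3, a4, a5, a2]
      have hint : ∫ s, (P.v₂ (q, s) : ℂ) * φ s = ∫ s, (P.v₂ (s, q) : ℂ) * g.snd (p, s) := by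
        refine integral_congr_ae ?_
        filter_upwards [hφc] with s hs
        rw [hs, P.v₂_symm]
      rw [hint]
      simp only [smul_eq_mul]
      ring
    have e3 : ‖P.fiber p f - z • f‖ ^ 2 = ‖G.fst p‖ ^ 2 + ∫ q, ‖G.snd (p, q)‖ ^ 2 := by
      rw [WithLp.prod_norm_sq_eq_of_L2, e1, norm_sq_eq_integral]
      congr 1
      refine integral_congr_ae ?_
      filter_upwards [e2] with q hq
      rw [hq]
    rw [← e0, ← e3, ← mul_pow]
    have := h p f
    gcongr
  have hnorm : ∀ k : ChannelSpace ν,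
      ‖k‖ ^ 2 = ∫ p, (‖k.fst p‖ ^ 2 + ∫ q, ‖k.snd (p, q)‖ ^ 2) := fun k => by
    rw [WithLp.prod_norm_sq_eq_of_L2, integral_add (integrable_norm_sq _)
      (integrable_norm_sq k.snd).integral_prod_left, norm_sq_eq_integral, norm_sq_eq_integral]
    congr 1
    exact integral_prod _ (integrable_norm_sq k.snd)
  have hint : ∀ k : ChannelSpace ν,
      Integrable fun p => ‖k.fst p‖ ^ 2 + ∫ q, ‖k.snd (p, q)‖ ^ 2 := fun k =>
    (integrable_norm_sq _).add (integrable_norm_sq k.snd).integral_prod_left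
  refine le_of_sq_le_sq ?_ (norm_nonneg _)
  rw [mul_pow, hnorm, hnorm, ← integral_const_mul]
  exact integral_mono_ae ((hint g).const_mul _) (hint G) hsec

theorem spectrum_channel_subset (hV₂ : P.V₂.IsPositive) :
    spectrum ℂ P.channel ⊆ ⋃ p, spectrum ℂ (P.fiber p) := by
  intro z hz
  by_contra hcon
  simp only [Set.mem_iUnion, not_exists] at hcon
  obtain ⟨c, hc, h⟩ := P.exists_uniform_bddBelow_fiber hcon
  exact notMem_spectrum_of_bddBelow (P.isSelfAdjoint_channel hV₂) hc (P.bddBelow_channel hc h) hz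

/-! ### Localized vectors -/

theorem channel_localize_sub_fst (p₀ : Torus ν) (z : ℂ) (χ : L2 (Torus ν)) (f : FiberSpace ν) :
    (P.channel (localize χ f) - z • localize χ f).fst =
      f.fst • mulOp (fun p => P.w₁ p - P.w₁ p₀) (by fun_prop) χ +
        (P.fiber p₀ f - z • f).fst • χ := by
  have h : P.H₁₁ χ = mulOp (fun p => P.w₁ p) (by fun_prop) χ := rfl
  rw [WithLp.sub_fst, WithLp.sub_fst, channel_fst, fiber_fst, WithLp.smul_fst, WithLp.smul_fst,
    mulOp_sub _ _ (by fun_prop) (by fun_prop), mulOp_const, ← h]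
  simp only [localize_fst, localize_snd, H₁₂_tensor, map_smul, smul_eq_mul]
  module

theorem channel_localize_sub_snd (p₀ : Torus ν) (z : ℂ) (χ : L2 (Torus ν)) (f : FiberSpace ν) :
    (P.channel (localize χ f) - z • localize χ f).snd =
      mulOp (fun x : Torus ν × Torus ν => P.w₂ x - P.w₂ (p₀, x.2)) (by fun_prop)
        (tensor χ f.snd) + tensor χ (P.fiber p₀ f - z • f).snd := by
  have h : P.H₂₂free (tensor χ f.snd) = mulOp (fun x => P.w₂ x) (by fun_prop) (tensor χ f.snd) :=
    rfl
  have hc : creation (fun q => P.v₁ q) P.v₁.continuous f.fst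
      = f.fst • creation (fun q => P.v₁ q) P.v₁.continuous 1 := by
    rw [creation_apply, creation_apply, one_smul]
  rw [WithLp.sub_snd, WithLp.sub_snd, channel_snd, fiber_snd, WithLp.smul_snd, WithLp.smul_snd,
    mulOp_sub _ _ (by fun_prop) (by fun_prop), ← h,
    mulOp_snd_tensor (fun q => P.w₂ (p₀, q)) (by fun_prop), hc]
  simp only [localize_fst, localize_snd, map_smul, map_add, map_sub, V₂_tensor, H₂₁left_eq_tensor]
  module

/-- Each of the two components contributes a fiber error and an error from freezing `w₁` or `w₂` at
`p₀`, all four at most `ε`. -/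
theorem eventually_norm_channel_localize_le {χ : ℕ → L2 (Torus ν)} {p₀ : Torus ν}
    (hχ : ConcentratesAt χ p₀) (z : ℂ) {f : FiberSpace ν} (hf : ‖f‖ = 1) {ε : ℝ} (hε : 0 < ε)
    (hfε : ‖P.fiber p₀ f - z • f‖ ≤ ε) :
    ∀ᶠ n in atTop, ‖P.channel (localize (χ n) f) - z • localize (χ n) f‖ ≤ 4 * ε := by
  filter_upwards [hχ.support _ (P.eventually_abs_w₁_sub_le p₀ hε),
    hχ.support _ (P.eventually_abs_w₂_sub_le p₀ hε)] with n h1 h2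
  refine (norm_le_norm_fst_add_norm_snd _).trans ?_
  rw [P.channel_localize_sub_fst p₀, P.channel_localize_sub_snd p₀]
  have a1 : ‖f.fst • mulOp (fun p => P.w₁ p - P.w₁ p₀) (by fun_prop) (χ n)‖ ≤ ε := by
    have := norm_mulOp_le (fun p => P.w₁ p - P.w₁ p₀) (by fun_prop) h1
    rw [hχ.norm_eq_one, mul_one] at this
    rw [norm_smul]
    have h3 := norm_fst_le_norm f
    rw [hf] at h3
    nlinarith [norm_nonneg f.fst]
  have a2 : ‖(P.fiber p₀ f - z • f).fst • χ n‖ ≤ ε := by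
    rw [norm_smul, hχ.norm_eq_one, mul_one]
    exact (norm_fst_le_norm _).trans hfε
  have a3 : ‖mulOp (fun x : Torus ν × Torus ν => P.w₂ x - P.w₂ (p₀, x.2)) (by fun_prop)
        (tensor (χ n) f.snd)‖ ≤ ε := by
    have h3 : ∀ᵐ x : Torus ν × Torus ν, tensor (χ n) f.snd x ≠ 0 →
        |P.w₂ x - P.w₂ (p₀, x.2)| ≤ ε := by
      filter_upwards [coeFn_tensor (χ n) f.snd, bp_fst.qmp.ae h2] with x h4 h5 h6
      rw [h4] at h6
      exact h5 (left_ne_zero_of_mul h6) x.2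
    have := norm_mulOp_le (fun x : Torus ν × Torus ν => P.w₂ x - P.w₂ (p₀, x.2))
      (by fun_prop) h3
    rw [norm_tensor, hχ.norm_eq_one, one_mul] at this
    have h6 := norm_snd_le_norm f
    rw [hf] at h6
    nlinarith
  have a4 : ‖tensor (χ n) (P.fiber p₀ f - z • f).snd‖ ≤ ε := by
    rw [norm_tensor, hχ.norm_eq_one, one_mul]
    exact (norm_snd_le_norm _).trans hfε
  linarith [norm_add_le (f.fst • mulOp (fun p => P.w₁ p - P.w₁ p₀) (by fun_prop) (χ n))
    ((P.fiber p₀ f - z • f).fst • χ n), norm_add_le (mulOp (fun x : Torus ν × Torus ν =>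
      P.w₂ x - P.w₂ (p₀, x.2)) (by fun_prop) (tensor (χ n) f.snd))
      (tensor (χ n) (P.fiber p₀ f - z • f).snd)]

theorem spectrum_fiber_subset_spectrum_channel (hν : 1 ≤ ν) (p₀ : Torus ν) :
    spectrum ℂ (P.fiber p₀) ⊆ spectrum ℂ P.channel := by
  intro z hz
  obtain ⟨χ, hχ⟩ := exists_concentratesAt hν p₀
  refine mem_spectrum_of_approx fun ε hε => ?_
  obtain ⟨f, hf, hfε⟩ := exists_unit_of_mem_spectrum (P.isSelfAdjoint_fiber p₀) hz
    (show 0 < ε / 4 by positivity)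
  refine ⟨fun n => localize (χ n) f,
    fun n => (norm_localize _ (hχ.norm_eq_one n) f).symm ▸ hf.ge, ?_⟩
  filter_upwards [P.eventually_norm_channel_localize_le hχ z hf (by positivity) hfε.le] with n hn
  linarith

end Parameters

/-! ### From the channel space to the Fock space -/

theorem ofReal_one_div_sqrt_two_mul_self :
    ((1 / √2 : ℝ) : ℂ) * ((1 / √2 : ℝ) : ℂ) = 1 / 2 := by
  rw [← Complex.ofReal_mul, div_mul_div_comm, Real.mul_self_sqrt (by norm_num)]
  norm_num

theorem norm_one_div_sqrt_two_le : ‖((1 / √2 : ℝ) : ℂ)‖ ≤ 1 := by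
  rw [Complex.norm_real, Real.norm_of_nonneg (by positivity), div_le_one (by positivity)]
  exact Real.one_le_sqrt.2 (by norm_num)

/-- The map `f ↦ f + flip f` onto the symmetric functions. -/
def symmetrize : L2 (Torus ν × Torus ν) →L[ℂ] symmL2 ν :=
  (ContinuousLinearMap.id ℂ _ + flip.toContinuousLinearMap).codRestrict (symmL2 ν) fun f =>
    mem_symmL2_iff.2 <| by
      change flip (f + flip f) = f + flip f
      rw [map_add, flip_flip, add_comm]

theorem coe_symmetrize (f : L2 (Torus ν × Torus ν)) :
    (symmetrize f : L2 (Torus ν × Torus ν)) = f + flip f := rfl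

theorem norm_symmetrize_le (f : L2 (Torus ν × Torus ν)) : ‖symmetrize f‖ ≤ 2 * ‖f‖ := by
  change ‖f + flip f‖ ≤ _
  refine (norm_add_le _ _).trans ?_
  rw [flip.norm_map]
  linarith

/-- The map `(g₁, g₂) ↦ (0, g₁, 2^{-1/2} (g₂ + flip g₂))` from the channel space to the Fock
space. -/
def toFock (g : ChannelSpace ν) : FockSpace ν :=
  WithLp.toLp 2 (0, WithLp.toLp 2 (g.fst, ((1 / √2 : ℝ) : ℂ) • symmetrize g.snd))

theorem toFock_fst (g : ChannelSpace ν) : (toFock g).fst = 0 := rfl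

theorem toFock_snd_fst (g : ChannelSpace ν) : (toFock g).snd.fst = g.fst := rfl

theorem toFock_snd_snd (g : ChannelSpace ν) :
    (toFock g).snd.snd = ((1 / √2 : ℝ) : ℂ) • symmetrize g.snd := rfl

/-- Symmetrizing loses no norm here: the cross term between `χ ⊗ f₁` and its flip `f₁ ⊗ χ` is `‖⟪χ,
f₁⟫‖²`, which is nonnegative. -/
theorem norm_le_norm_toFock_localize {χ : L2 (Torus ν)} (hχ : ‖χ‖ = 1) (f : FiberSpace ν) :
    ‖f‖ ≤ ‖toFock (localize χ f)‖ := by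
  rw [← norm_localize χ hχ f]
  have h1 : ‖((1 / √2 : ℝ) : ℂ) • symmetrize (tensor χ f.snd)‖ ^ 2
      = ‖tensor χ f.snd‖ ^ 2 + ‖inner ℂ χ f.snd‖ ^ 2 := by
    have h2 : ‖symmetrize (tensor χ f.snd)‖ ^ 2
        = 2 * (‖tensor χ f.snd‖ ^ 2 + ‖inner ℂ χ f.snd‖ ^ 2) := by
      change ‖tensor χ f.snd + flip (tensor χ f.snd)‖ ^ 2 = _
      rw [norm_add_sq (𝕜 := ℂ), flip.norm_map, flip_tensor, inner_tensor,
        ← inner_conj_symm f.snd χ, Complex.mul_conj, Complex.normSq_eq_norm_sq]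
      simp only [RCLike.re_to_complex, Complex.ofReal_re]
      ring
    rw [norm_smul, mul_pow, h2, Complex.norm_real, Real.norm_of_nonneg (by positivity), div_pow,
      Real.sq_sqrt (by norm_num)]
    ring
  refine le_of_sq_le_sq ?_ (norm_nonneg _)
  have h3 : ‖localize χ f‖ ^ 2 = ‖f.fst • χ‖ ^ 2 + ‖tensor χ f.snd‖ ^ 2 := norm_toLp_sq _ _
  have h4 : ‖toFock (localize χ f)‖ ^ 2 = ‖(0 : ℂ)‖ ^ 2 + (‖f.fst • χ‖ ^ 2 +
      ‖((1 / √2 : ℝ) : ℂ) • symmetrize (tensor χ f.snd)‖ ^ 2) := by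
    rw [← norm_toLp_sq (f.fst • χ)]
    exact norm_toLp_sq _ _
  rw [h3, h4, h1, norm_zero]
  nlinarith [sq_nonneg ‖inner ℂ χ f.snd‖]

namespace Parameters

variable (P : Parameters ν)

theorem H_fst (u : FockSpace ν) : (P.H u).fst = P.H₀₀ u.fst + P.H₀₁ u.snd.fst := rfl

theorem H_snd_fst (u : FockSpace ν) :
    (P.H u).snd.fst = P.H₁₀ u.fst + (P.H₁₁ u.snd.fst + P.H₁₂ u.snd.snd) := rfl

theorem H_snd_snd (u : FockSpace ν) :
    (P.H u).snd.snd = 0 + (P.H₂₁ u.snd.fst + P.H₂₂ u.snd.snd) := rfl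

theorem H_toFock_sub_fst (z : ℂ) (g : ChannelSpace ν) :
    (P.H (toFock g) - z • toFock g).fst = P.H₀₁ g.fst := by
  rw [WithLp.sub_fst, WithLp.smul_fst, H_fst, toFock_fst, toFock_snd_fst, map_zero, smul_zero,
    sub_zero, zero_add]

theorem H_toFock_sub_snd_fst (z : ℂ) (g : ChannelSpace ν) :
    (P.H (toFock g) - z • toFock g).snd.fst = (P.channel g - z • g).fst +
      ((1 / √2 : ℝ) : ℂ) • P.H₁₂ (flip g.snd) := by
  simp only [WithLp.sub_fst, WithLp.smul_fst, WithLp.sub_snd, WithLp.smul_snd, H_snd_fst,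
    toFock_fst, toFock_snd_fst, toFock_snd_snd, map_zero, channel_fst, Submodule.coe_smul,
    coe_symmetrize, map_smul, map_add]
  module

/-- Together with the two preceding identities: `toFock` intertwines `H` with the channel operator
up to `H₀₁`, `H₁₂ ∘ flip` and `V₁`. The factors `2^{-1/2}` match because their product is the `1/2`
in `H₂₁`. -/
theorem H_toFock_sub_snd_snd (z : ℂ) (g : ChannelSpace ν) :
    (P.H (toFock g) - z • toFock g).snd.snd =
      ((1 / √2 : ℝ) : ℂ) • symmetrize ((P.channel g - z • g).snd - P.V₁ g.snd) := by
  apply Subtype.ext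
  simp only [WithLp.sub_snd, WithLp.smul_snd, H_snd_snd,
    toFock_snd_fst, toFock_snd_snd, channel_snd, Submodule.coe_smul, Submodule.coe_sub,
    Submodule.coe_add, coe_symmetrize, map_smul, map_add, map_sub, coe_H₂₁, coe_H₂₂, zero_add,
    smul_add, smul_sub, flip_V₁, flip_V₂, flip_H₂₂free, flip_H₂₁left, smul_smul,
    ofReal_one_div_sqrt_two_mul_self]
  module

theorem spectrum_fiber_subset_essentialSpectrum_H (hν : 1 ≤ ν) (hV₁ : P.V₁.IsPositive)
    (hV₂ : P.V₂.IsPositive) (p₀ : Torus ν) :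
    spectrum ℂ (P.fiber p₀) ⊆ essentialSpectrum P.H := by
  intro z hz
  obtain ⟨χ, hχ⟩ := exists_concentratesAt hν p₀
  refine mem_essentialSpectrum_of_weaklyNull (P.isSelfAdjoint_H hV₁ hV₂) fun ε hε => ?_
  obtain ⟨f, hf, hfε⟩ := exists_unit_of_mem_spectrum (P.isSelfAdjoint_fiber p₀) hz
    (show 0 < ε / 24 by positivity)
  refine ⟨fun n => toFock (localize (χ n) f), ?_, fun n => ?_, ?_⟩
  · have h1 : WeaklyNull fun n => f.fst • χ n :=
      hχ.weaklyNull.map (f.fst • ContinuousLinearMap.id ℂ (L2 (Torus ν)))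
    have h2 : WeaklyNull fun n => ((1 / √2 : ℝ) : ℂ) • symmetrize (tensor (χ n) f.snd) :=
      hχ.weaklyNull.map (((1 / √2 : ℝ) : ℂ) • (symmetrize ∘L tensor.flip f.snd))
    exact weaklyNull_zero.toLp (h1.toLp h2)
  · exact hf.ge.trans (norm_le_norm_toFock_localize (hχ.norm_eq_one n) f)
  have a1 : Tendsto (fun n => P.H₀₁ (f.fst • χ n)) atTop (𝓝 0) := by
    have := (hχ.weaklyNull.tendsto_functional P.v₀.continuous).const_smul f.fst
    simp only [smul_zero] at this
    refine this.congr fun n => ?_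
    rw [map_smul]
    rfl
  have a2 : Tendsto (fun n => ((1 / √2 : ℝ) : ℂ) • P.H₁₂ (flip (tensor (χ n) f.snd)))
      atTop (𝓝 0) := by
    have := ((hχ.weaklyNull.tendsto_functional P.v₁.continuous).smul_const f.snd).const_smul
      ((1 / √2 : ℝ) : ℂ)
    simp only [zero_smul, smul_zero] at this
    refine this.congr fun n => ?_
    rw [flip_tensor, H₁₂_tensor]
  have a3 : Tendsto (fun n => P.V₁ (tensor (χ n) f.snd)) atTop (𝓝 0) := by
    simp only [V₁_tensor]
    have := ((tensor.flip f.snd).continuous.tendsto 0).comp (P.tendsto_v hχ.weaklyNull)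
    rw [map_zero] at this
    exact this
  -- The channel error is at most `4 · ε/24 = ε/6`. The three components then cost at most `ε/12`,
  -- `ε/6 + ε/12` and `2 (ε/6 + ε/12)`, in total below `ε`.
  have hε' : 0 < ε / 12 := by positivity
  filter_upwards [P.eventually_norm_channel_localize_le hχ z hf (by positivity) hfε.le,
    a1.norm.eventually_lt_const (norm_zero.trans_lt hε'),
    a2.norm.eventually_lt_const (norm_zero.trans_lt hε'),
    a3.norm.eventually_lt_const (norm_zero.trans_lt hε')] with n h0 h1 h2 h3
  set g := localize (χ n) f
  have b0 := norm_le_norm_fst_add_norm_snd (P.H (toFock g) - z • toFock g)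
  have b1 := norm_le_norm_fst_add_norm_snd (P.H (toFock g) - z • toFock g).snd
  rw [H_toFock_sub_fst] at b0
  rw [H_toFock_sub_snd_fst, H_toFock_sub_snd_snd] at b1
  have b2 : ‖((1 / √2 : ℝ) : ℂ) • symmetrize ((P.channel g - z • g).snd - P.V₁ g.snd)‖ ≤
      2 * (‖P.channel g - z • g‖ + ‖P.V₁ g.snd‖) := by
    rw [norm_smul]
    have c1 := norm_symmetrize_le ((P.channel g - z • g).snd - P.V₁ g.snd)
    have c2 := norm_sub_le (P.channel g - z • g).snd (P.V₁ g.snd)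
    have c3 := norm_snd_le_norm (P.channel g - z • g)
    have c4 := mul_le_mul_of_nonneg_right norm_one_div_sqrt_two_le
      (norm_nonneg (symmetrize ((P.channel g - z • g).snd - P.V₁ g.snd)))
    linarith
  have b3 := norm_add_le (P.channel g - z • g).fst (((1 / √2 : ℝ) : ℂ) • P.H₁₂ (flip g.snd))
  have b4 := norm_fst_le_norm (P.channel g - z • g)
  change ‖P.H₀₁ g.fst‖ < _ at h1
  change ‖((1 / √2 : ℝ) : ℂ) • P.H₁₂ (flip g.snd)‖ < _ at h2
  change ‖P.V₁ g.snd‖ < _ at h3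
  linarith

/-! ### The essential spectrum of `H` inside the channel spectrum -/

theorem mem_spectrum_channel_of_w₂_eq (hν : 1 ≤ ν) (x : Torus ν × Torus ν) :
    ((P.w₂ x : ℝ) : ℂ) ∈ spectrum ℂ P.channel :=
  P.spectrum_fiber_subset_spectrum_channel hν x.1 (P.mem_spectrum_fiber hν x.1 x.2)

theorem tendsto_H₁₂_mulOp {r : Torus ν × Torus ν → ℝ} (hr : Continuous r)
    {f₁ : ℕ → L2 (Torus ν)} {f₂ : ℕ → L2 (Torus ν × Torus ν)} (w1 : WeaklyNull f₁)
    (w2 : WeaklyNull f₂) :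
    Tendsto (fun n => P.H₁₂ (mulOp r hr (P.V₁ (f₂ n) - (1 / 2 : ℂ) • P.H₂₁right (f₁ n))))
      atTop (𝓝 0) := by
  have h1 : Tendsto (fun n => P.H₁₂ (mulOp r hr (P.V₁ (f₂ n)))) atTop (𝓝 0) :=
    P.tendsto_partialIntegral_V₁ (X := Torus ν) (π := fun x => x) (by fun_prop) bp_id hr w2
      continuous_id
  have h2 : Tendsto (fun n => P.H₁₂ (mulOp r hr (P.H₂₁right (f₁ n)))) atTop (𝓝 0) :=
    P.tendsto_partialIntegral_H₂₁right (X := Torus ν) (π := fun x => x) (by fun_prop) bp_id hr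
      w1 continuous_id
  have h3 := h1.sub (h2.const_smul (1 / 2 : ℂ))
  rw [smul_zero, sub_zero] at h3
  refine h3.congr fun n => ?_
  simp only [map_sub, map_smul]

theorem tendsto_V₂_mulOp {r : Torus ν × Torus ν → ℝ} (hr : Continuous r)
    {f₁ : ℕ → L2 (Torus ν)} {f₂ : ℕ → L2 (Torus ν × Torus ν)} (w1 : WeaklyNull f₁)
    (w2 : WeaklyNull f₂) :
    Tendsto (fun n => P.V₂ (mulOp r hr (P.V₁ (f₂ n) - (1 / 2 : ℂ) • P.H₂₁right (f₁ n))))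
      atTop (𝓝 0) := by
  have h1 : Tendsto (fun n => P.V₂ (mulOp r hr (P.V₁ (f₂ n)))) atTop (𝓝 0) :=
    P.tendsto_partialIntegral_V₁ (X := Torus ν × Torus ν) (π := fun x => x.1) (by fun_prop)
      bp_fst_last hr w2 continuous_fst
  have h2 : Tendsto (fun n => P.V₂ (mulOp r hr (P.H₂₁right (f₁ n)))) atTop (𝓝 0) :=
    P.tendsto_partialIntegral_H₂₁right (X := Torus ν × Torus ν) (π := fun x => x.1)
      (by fun_prop) bp_fst_last hr w1 continuous_fst
  have h3 := h1.sub (h2.const_smul (1 / 2 : ℂ))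
  rw [smul_zero, sub_zero] at h3
  refine h3.congr fun n => ?_
  simp only [map_sub, map_smul]

/-- A Faddeev-type argument: `S` is multiplication by `w₂ - z`, `R` its inverse, and `g` holds the
terms the channel operator lacks. Replacing `f₂` by `f₂ - R g` removes `g` from the equation, at the
price of `H₁₂ R g` and `V₂ R g`, which vanish by `c1` and `c2`. -/
theorem tendsto_zero_of_bddBelow_channel {z : ℂ} {c : ℝ} (hc : 0 < c)
    (hbd : ∀ g, c * ‖g‖ ≤ ‖P.channel g - z • g‖)
    {R S : L2 (Torus ν × Torus ν) →L[ℂ] L2 (Torus ν × Torus ν)}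
    (hSapp : ∀ f, S f = P.H₂₂free f - z • f) (hSR : ∀ f, S (R f) = f) (hRS : ∀ f, R (S f) = f)
    {f₁ : ℕ → L2 (Torus ν)} {f₂ g : ℕ → L2 (Torus ν × Torus ν)}
    (hg : ∀ n, g n = P.V₁ (f₂ n) - (1 / 2 : ℂ) • P.H₂₁right (f₁ n))
    (hsymm : ∀ n, flip (f₂ n) = f₂ n)
    (e1 : Tendsto (fun n => P.H₁₁ (f₁ n) + P.H₁₂ (f₂ n) - z • f₁ n) atTop (𝓝 0))
    (e2 : Tendsto (fun n => (1 / 2 : ℂ) • (P.H₂₁right (f₁ n) + P.H₂₁left (f₁ n)) +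
      (S (f₂ n) - P.V₁ (f₂ n) - P.V₂ (f₂ n))) atTop (𝓝 0))
    (c1 : Tendsto (fun n => P.H₁₂ (R (g n))) atTop (𝓝 0))
    (c2 : Tendsto (fun n => P.V₂ (R (g n))) atTop (𝓝 0)) :
    Tendsto f₁ atTop (𝓝 0) ∧ Tendsto f₂ atTop (𝓝 0) := by
  set κ : ℂ := ((1 / √2 : ℝ) : ℂ) with hκ
  have hκ2 : κ * (2 * κ) = 1 := by
    rw [mul_left_comm, ofReal_one_div_sqrt_two_mul_self]; norm_num
  -- The factor `2κ = √2` undoes the `κ` in front of `H₁₂` and turns the `1/2` of `H₂₁` into the `κ`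
  -- of the channel operator.
  set y : ℕ → ChannelSpace ν := fun n => WithLp.toLp 2 (f₁ n, (2 * κ) • (f₂ n - R (g n))) with hy
  have y1 : Tendsto (fun n => (P.channel (y n) - z • y n).fst) atTop (𝓝 0) := by
    have h1 := e1.sub c1
    rw [sub_zero] at h1
    refine h1.congr fun n => ?_
    rw [WithLp.sub_fst, WithLp.smul_fst, channel_fst]
    change _ = P.H₁₁ (f₁ n) + κ • P.H₁₂ ((2 * κ) • (f₂ n - R (g n))) - z • f₁ n
    rw [map_smul, smul_smul, hκ2, one_smul, map_sub]
    abel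
  have y2 : Tendsto (fun n => (P.channel (y n) - z • y n).snd) atTop (𝓝 0) := by
    have h1 := (e2.add c2).const_smul (2 * κ)
    rw [add_zero, smul_zero] at h1
    refine h1.congr fun n => ?_
    rw [WithLp.sub_snd, WithLp.smul_snd, channel_snd]
    change _ = κ • P.H₂₁left (f₁ n) + (P.H₂₂free ((2 * κ) • (f₂ n - R (g n))) -
      P.V₂ ((2 * κ) • (f₂ n - R (g n)))) - z • (2 * κ) • (f₂ n - R (g n))
    have h2 : P.H₂₂free (R (g n)) = g n + z • R (g n) := by
      rw [← sub_eq_iff_eq_add, ← hSapp, hSR]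
    rw [map_smul, map_smul, map_sub, map_sub, h2, hSapp]
    simp only [hg]
    module
  have hy0 : Tendsto y atTop (𝓝 0) := by
    have h1 := (y1.norm.add y2.norm).const_mul c⁻¹
    simp only [norm_zero, add_zero, mul_zero] at h1
    refine squeeze_zero_norm (fun n => ?_) h1
    rw [le_inv_mul_iff₀ hc]
    exact (hbd (y n)).trans (norm_le_norm_fst_add_norm_snd _)
  have l1 : Tendsto f₁ atTop (𝓝 0) := by
    have := ((WithLp.fstL 2 ℂ (L2 (Torus ν))
      (L2 (Torus ν × Torus ν))).continuous.tendsto 0).comp hy0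
    rw [map_zero] at this
    exact this
  have hr : Tendsto (fun n => P.H₂₁right (f₁ n)) atTop (𝓝 0) := by
    have := (P.H₂₁right.continuous.tendsto 0).comp l1
    rwa [map_zero] at this
  have hl : Tendsto (fun n => P.H₂₁left (f₁ n)) atTop (𝓝 0) := by
    have := (P.H₂₁left.continuous.tendsto 0).comp l1
    rwa [map_zero] at this
  -- Applying `S` to the second component of `y` gives `S f₂ - g → 0`, and the `f₁` part of `g`
  -- already vanishes.
  have l2 : Tendsto (fun n => S (f₂ n) - P.V₁ (f₂ n)) atTop (𝓝 0) := by
    have h1 := ((κ • (S ∘L WithLp.sndL 2 ℂ (L2 (Torus ν))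
      (L2 (Torus ν × Torus ν)))).continuous.tendsto 0).comp hy0
    rw [map_zero] at h1
    have h2 := h1.sub (hr.const_smul (1 / 2 : ℂ))
    rw [smul_zero, sub_zero] at h2
    refine h2.congr fun n => ?_
    change κ • S ((2 * κ) • (f₂ n - R (g n))) - _ = _
    rw [map_smul, smul_smul, hκ2, one_smul, map_sub, hSR]
    simp only [hg]
    abel
  have l3 : Tendsto (fun n => P.V₂ (f₂ n)) atTop (𝓝 0) := by
    have h1 := (l2.sub e2).add ((hr.add hl).const_smul (1 / 2 : ℂ))
    simp only [add_zero, smul_zero, sub_zero] at h1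
    refine h1.congr fun n => ?_
    abel
  -- Symmetry of `f₂` is decisive: the flip exchanges `V₁` and `V₂`, so the limit for `V₂ f₂` passes
  -- to `V₁ f₂`, and then `S f₂ → 0` gives `f₂ → 0`.
  have l4 : Tendsto (fun n => P.V₁ (f₂ n)) atTop (𝓝 0) := by
    have h1 := (flip.continuous.tendsto 0).comp l3
    rw [map_zero] at h1
    refine h1.congr fun n => ?_
    rw [Function.comp_apply, flip_V₂, hsymm]
  have l5 : Tendsto f₂ atTop (𝓝 0) := by
    have h1 := l2.add l4
    rw [add_zero] at h1
    have h2 := (R.continuous.tendsto 0).comp h1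
    rw [map_zero] at h2
    refine h2.congr fun n => ?_
    rw [Function.comp_apply, sub_add_cancel, hRS]
  exact ⟨l1, l5⟩

theorem tendsto_snd_fst_of_tendsto_H_sub {z : ℂ} {u : ℕ → FockSpace ν}
    (hlim : Tendsto (fun n => P.H (u n) - z • u n) atTop (𝓝 0))
    (w0 : Tendsto (fun n => (u n).fst) atTop (𝓝 0)) :
    Tendsto (fun n => P.H₁₁ (u n).snd.fst + P.H₁₂ (u n).snd.snd - z • (u n).snd.fst)
      atTop (𝓝 0) := by
  have h1 := ((WithLp.fstL 2 ℂ (L2 (Torus ν)) (symmL2 ν) ∘L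
    WithLp.sndL 2 ℂ ℂ (WithLp 2 (L2 (Torus ν) × symmL2 ν))).continuous.tendsto 0).comp hlim
  have h2 := (P.H₁₀.continuous.tendsto 0).comp w0
  rw [map_zero] at h1 h2
  have h3 := h1.sub h2
  rw [sub_zero] at h3
  refine h3.congr fun n => ?_
  change (P.H (u n) - z • u n).snd.fst - P.H₁₀ (u n).fst = _
  simp only [WithLp.sub_fst, WithLp.smul_fst, WithLp.sub_snd, WithLp.smul_snd, H_snd_fst]
  abel

theorem tendsto_snd_snd_of_tendsto_H_sub {z : ℂ} {u : ℕ → FockSpace ν}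
    (hlim : Tendsto (fun n => P.H (u n) - z • u n) atTop (𝓝 0)) :
    Tendsto (fun n => (1 / 2 : ℂ) • (P.H₂₁right (u n).snd.fst + P.H₂₁left (u n).snd.fst) +
      (P.H₂₂free (u n).snd.snd - z • ((u n).snd.snd : L2 (Torus ν × Torus ν)) -
        P.V₁ (u n).snd.snd - P.V₂ (u n).snd.snd)) atTop (𝓝 0) := by
  have h1 := (((symmL2 ν).subtypeL ∘L WithLp.sndL 2 ℂ (L2 (Torus ν)) (symmL2 ν) ∘L
    WithLp.sndL 2 ℂ ℂ (WithLp 2 (L2 (Torus ν) × symmL2 ν))).continuous.tendsto 0).comp hlim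
  rw [map_zero] at h1
  refine h1.congr fun n => ?_
  change (((P.H (u n) - z • u n).snd.snd : symmL2 ν) : L2 (Torus ν × Torus ν)) = _
  simp only [WithLp.sub_snd, WithLp.smul_snd, H_snd_snd, zero_add, Submodule.coe_sub,
    Submodule.coe_add, Submodule.coe_smul, coe_H₂₁, coe_H₂₂]
  abel

theorem essentialSpectrum_H_subset (hν : 1 ≤ ν) (hV₁ : P.V₁.IsPositive)
    (hV₂ : P.V₂.IsPositive) : essentialSpectrum P.H ⊆ spectrum ℂ P.channel := by
  intro z hz
  by_contra hcon
  have hre := eq_re_of_mem_essentialSpectrum (P.isSelfAdjoint_H hV₁ hV₂) hz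
  -- Values of `w₂` belong to the channel spectrum, so they avoid `z`; this makes the inverse
  -- multiplication operator bounded.
  have hne : ∀ x, P.w₂ x - z.re ≠ 0 := fun x h => hcon <| by
    have := P.mem_spectrum_channel_of_w₂_eq hν x
    rwa [sub_eq_zero.1 h, ← hre] at this
  have hk : Continuous fun x => P.w₂ x - z.re := by fun_prop
  have hk' := hk.inv₀ hne
  have hSapp : ∀ f, mulOp _ hk f = P.H₂₂free f - z • f := fun f => by
    rw [mulOp_sub _ _ (by fun_prop) (by fun_prop), mulOp_const, ← hre]
    rfl
  obtain ⟨u, hu, hu1, hlim⟩ :=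
    exists_weaklyNull_of_mem_essentialSpectrum (P.isSelfAdjoint_H hV₁ hV₂) hz
  obtain ⟨c, hc, hbd⟩ := bddBelow_of_notMem_spectrum hcon
  have w0 : Tendsto (fun n => (u n).fst) atTop (𝓝 0) :=
    (hu.map (WithLp.fstL 2 ℂ ℂ (WithLp 2 (L2 (Torus ν) × symmL2 ν)))).tendsto_zero
  have ws := hu.map (WithLp.sndL 2 ℂ ℂ (WithLp 2 (L2 (Torus ν) × symmL2 ν)))
  have w1 : WeaklyNull fun n => (u n).snd.fst :=
    ws.map (WithLp.fstL 2 ℂ (L2 (Torus ν)) (symmL2 ν))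
  have w2 : WeaklyNull fun n => ((u n).snd.snd : L2 (Torus ν × Torus ν)) :=
    (ws.map (WithLp.sndL 2 ℂ (L2 (Torus ν)) (symmL2 ν))).map (symmL2 ν).subtypeL
  have e2 := P.tendsto_snd_snd_of_tendsto_H_sub hlim
  simp only [← hSapp] at e2
  obtain ⟨l1, l2⟩ := P.tendsto_zero_of_bddBelow_channel hc hbd hSapp
    (mulOp_mulOp_inv hk hne) (mulOp_inv_mulOp hk hne) (fun n => rfl)
    (fun n => mem_symmL2_iff.1 (u n).snd.snd.2) (P.tendsto_snd_fst_of_tendsto_H_sub hlim w0) e2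
    (P.tendsto_H₁₂_mulOp hk' w1 w2) (P.tendsto_V₂_mulOp hk' w1 w2)
  have h1 := w0.norm.add (l1.norm.add l2.norm)
  simp only [norm_zero, add_zero] at h1
  obtain ⟨n, hn⟩ := (h1.eventually_lt_const one_pos).exists
  have b1 := norm_le_norm_fst_add_norm_snd (u n)
  have b2 := norm_le_norm_fst_add_norm_snd (u n).snd
  rw [Submodule.coe_norm] at b2
  linarith [hu1 n]

/-! ### The union of the fiber spectra -/

theorem image_Icc_m_M :
    (fun x : ℝ => (x : ℂ)) '' Set.Icc P.m P.M = Set.range fun x => ((P.w₂ x : ℝ) : ℂ) := by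
  have hconn : IsPreconnected (Set.range P.w₂) := isPreconnected_range P.w₂.continuous
  have hcomp : IsCompact (Set.range P.w₂) := isCompact_range P.w₂.continuous
  have hne : (Set.range P.w₂).Nonempty := Set.range_nonempty _
  have h : Set.Icc P.m P.M = Set.range P.w₂ := by
    refine Set.Subset.antisymm (hconn.Icc_subset (hcomp.sInf_mem hne) (hcomp.sSup_mem hne)) ?_
    rintro _ ⟨x, rfl⟩
    exact ⟨ciInf_le hcomp.bddBelow x, le_ciSup hcomp.bddAbove x⟩
  rw [h, ← Set.range_comp]
  rfl

theorem iUnion_spectrum_fiber (hν : 1 ≤ ν) :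
    ⋃ p, spectrum ℂ (P.fiber p) = (⋃ p, discreteSpectrum (P.fiber p)) ∪
      (fun x : ℝ => (x : ℂ)) '' Set.Icc P.m P.M := by
  rw [image_Icc_m_M]
  refine Set.Subset.antisymm (Set.iUnion_subset fun p z hz => ?_) (Set.union_subset ?_ ?_)
  · by_cases hd : z ∈ discreteSpectrum (P.fiber p)
    · exact Or.inl (Set.mem_iUnion.2 ⟨p, hd⟩)
    · obtain ⟨q, rfl⟩ := P.mem_range_of_mem_essentialSpectrum_fiber ⟨hz, hd⟩
      exact Or.inr ⟨(p, q), rfl⟩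
  · exact Set.iUnion_mono fun p z hz => hz.1
  · rintro _ ⟨x, rfl⟩
    exact Set.mem_iUnion.2 ⟨x.1, P.mem_spectrum_fiber hν x.1 x.2⟩

end Parameters

end FockModel

end

theorem theorem2 (ν : ℕ) (hν : 1 ≤ ν) (P : FockModel.Parameters ν)
    (hV₁ : P.V₁.IsPositive) (hV₂ : P.V₂.IsPositive) :
    FockModel.essentialSpectrum P.H = spectrum ℂ P.channel ∧
      spectrum ℂ P.channel =
        (⋃ p : FockModel.Torus ν, FockModel.discreteSpectrum (P.fiber p)) ∪
          (fun x : ℝ => (x : ℂ)) '' Set.Icc P.m P.M := by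
  refine ⟨(P.essentialSpectrum_H_subset hν hV₁ hV₂).antisymm ?_, ?_⟩
  · exact (P.spectrum_channel_subset hV₂).trans
      (Set.iUnion_subset (P.spectrum_fiber_subset_essentialSpectrum_H hν hV₁ hV₂))
  · rw [← P.iUnion_spectrum_fiber hν]
    exact (P.spectrum_channel_subset hV₂).antisymm
      (Set.iUnion_subset (P.spectrum_fiber_subset_spectrum_channel hν))
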